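/- **Conventions.** Manifolds are smooth, Hausdorff, finite-dimensional and without boundary. A locally conformal Kähler (l.c.K.) manifold $(M,g,J)$ with Lee form $\omega$ is a Hermitian manifold ($J$ an integrable almost complex structure, $g(J\cdot,J\cdot)=g$) with a closed $1$-form $\omega$ on $M$ such that $d\Omega=\omega\wedge\Omega$, where $\Omega(X,Y)=g(X,JY)$. The Lee vector field $B_1=\omega^\sharp$ is defined by $g(X,B_1)=\omega(X)$. A Riemannian submersion $\pi:(M,g)\to(B,g_B)$ is a smooth surjective map of maximal rank whose differential preserves the lengths of horizontal vectors; $\mathcal V,\mathcal H$ are the orthogonal projections onto $\ker\pi_*$ and $(\ker\pi_*)^\perp$. It is anti-invariant if $J(\ker\pi_*)\subseteq(\ker\pi_*)^\perp$. For horizontal $X$ write $JX=BX+CX$ with $BX=\mathcal V JX$ and $CX=\mathcal H JX$. With $\nabla$ the Levi-Civita connection of $g$, put $\mathcal A_EF=\mathcal H\nabla_{\mathcal HE}\mathcal VF+\mathcal V\nabla_{\mathcal HE}\mathcal HF$, and $(\nabla\pi_*)(X,Y)=\nabla^\pi_X\pi_*Y-\pi_*(\nabla_XY)$, where $\nabla^\pi$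 is the pullback along $\pi$ of the Levi-Civita connection of $g_B$. The horizontal distribution $(\ker\pi_*)^\perp$ defines a totally geodesic foliation if for all $X,Y\in\Gamma((\ker\pi_*)^\perp)$ both $[X,Y]$ and $\nabla_XY$ are horizontal. **Theorem 4.1.** Let $\pi$ be an anti-invariant Riemannian submersion from an l.c.K. manifold $(M,g,J)$ with Lee form $\omega$ onto a Riemannian manifold $(B,g_B)$, and assume that the Lee vector field $B_1$ is vertical, $B_1\in\Gamma(\ker\pi_*)$. Then the following are equivalent: (a) $(\ker\pi_*)^\perp$ defines a totally geodesic foliation on $M$; (b) for all $X,Y\in\Gamma((\ker\pi_*)^\perp)$ and $V\in\Gamma(\ker\pi_*)$, $$g(\mathcal A_XBY,JV)=g(CY,J\mathcal A_XV)-\tfrac12\omega(V)g(CY,CX)+\tfrac12g(BY,B_1)g(X,JV)+\tfrac12g(X,Y)g(B_1,V);$$ (c) for all $X,Y\in\Gamma((\ker\pi_*)^\perp)$ and $V\in\Gamma(\ker\pi_*)$, $$g_B((\nabla\pi_*)(X,JY),\pi_*JV)=-g(CY,J\mathcal A_XV)+\tfrac12\omega(V)g(CY,CX)-\tfrac12g(BY,B_1)g(X,JV)-\tfrac12g(X,Y)g(B_1,V).$$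 -/

import Mathlib

open Manifold
open scoped ContDiff

noncomputable section

namespace LCK

section Basic

variable {E : Type*} [NormedAddCommGroup E] [NormedSpace ℝ E]
  {M : Type*} [TopologicalSpace M] [ChartedSpace E M]

/-- (Not necessarily smooth) vector fields on a manifold `M` modelled on `E`. -/
abbrev VField (E : Type*) [NormedAddCommGroup E] [NormedSpace ℝ E]
    (M : Type*) [TopologicalSpace M] [ChartedSpace E M] :=
  ∀ x : M, TangentSpace 𝓘(ℝ, E) x

/-- Fields of endomorphisms of the tangent spaces. -/
abbrev EndField (E : Type*) [NormedAddCommGroup E] [NormedSpace ℝ E]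
    (M : Type*) [TopologicalSpace M] [ChartedSpace E M] :=
  ∀ x : M, TangentSpace 𝓘(ℝ, E) x →L[ℝ] TangentSpace 𝓘(ℝ, E) x

/-- (Not necessarily smooth) 1-forms. -/
abbrev OneForm (E : Type*) [NormedAddCommGroup E] [NormedSpace ℝ E]
    (M : Type*) [TopologicalSpace M] [ChartedSpace E M] :=
  ∀ x : M, TangentSpace 𝓘(ℝ, E) x →L[ℝ] ℝ

/-- Smoothness of a vector field. -/
def SmoothVF [IsManifold 𝓘(ℝ, E) ∞ M] (X : VField E M) : Prop :=
  ContMDiff 𝓘(ℝ, E) (𝓘(ℝ, E).prod 𝓘(ℝ, E)) ∞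
    (fun x => Bundle.TotalSpace.mk' E (E := fun y : M => TangentSpace 𝓘(ℝ, E) y) x (X x))

/-- Smoothness of a field of endomorphisms. -/
def SmoothEnd [IsManifold 𝓘(ℝ, E) ∞ M] (J : EndField E M) : Prop :=
  ContMDiff 𝓘(ℝ, E) (𝓘(ℝ, E).prod 𝓘(ℝ, E →L[ℝ] E)) ∞
    (fun x => Bundle.TotalSpace.mk' (E →L[ℝ] E)
      (E := fun y : M => TangentSpace 𝓘(ℝ, E) y →L[ℝ] TangentSpace 𝓘(ℝ, E) y) x (J x))

/-- Smoothness of a 1-form. -/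
def SmoothForm [IsManifold 𝓘(ℝ, E) ∞ M] (lee : OneForm E M) : Prop :=
  ContMDiff 𝓘(ℝ, E) (𝓘(ℝ, E).prod 𝓘(ℝ, E →L[ℝ] ℝ)) ∞
    (fun x => Bundle.TotalSpace.mk' (E →L[ℝ] ℝ)
      (E := fun y : M => TangentSpace 𝓘(ℝ, E) y →L[ℝ] ℝ) x (lee x))

/-- The derivative `X f` of a function along a vector field. -/
def dirDeriv (X : VField E M) (f : M → ℝ) : M → ℝ :=
  fun x => mfderiv 𝓘(ℝ, E) 𝓘(ℝ, ℝ) f x (X x)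

/-- Exterior derivative of a 1-form: `dω(X,Y) = X ω(Y) - Y ω(X) - ω([X,Y])`. -/
def extDeriv₁ (lee : OneForm E M) (X Y : VField E M) (x : M) : ℝ :=
  dirDeriv X (fun y => lee y (Y y)) x - dirDeriv Y (fun y => lee y (X y)) x
    - lee x (VectorField.mlieBracket 𝓘(ℝ, E) X Y x)

/-- Exterior derivative of a 2-form `Ω`, evaluated on three vector fields. -/
def extDeriv₂ (Ω : ∀ x : M, TangentSpace 𝓘(ℝ, E) x → TangentSpace 𝓘(ℝ, E) x → ℝ)
    (X Y Z : VField E M) (x : M) : ℝ :=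
  dirDeriv X (fun y => Ω y (Y y) (Z y)) x
    - dirDeriv Y (fun y => Ω y (X y) (Z y)) x
    + dirDeriv Z (fun y => Ω y (X y) (Y y)) x
    - Ω x (VectorField.mlieBracket 𝓘(ℝ, E) X Y x) (Z x)
    + Ω x (VectorField.mlieBracket 𝓘(ℝ, E) X Z x) (Y x)
    - Ω x (VectorField.mlieBracket 𝓘(ℝ, E) Y Z x) (X x)

/-- The Nijenhuis tensor `[JX,JY] - J[JX,Y] - J[X,JY] - [X,Y]` of an almost complex structure. -/
def nijenhuis (J : EndField E M) (X Y : VField E M) (x : M) : TangentSpace 𝓘(ℝ, E) x :=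
  VectorField.mlieBracket 𝓘(ℝ, E) (fun y => J y (X y)) (fun y => J y (Y y)) x
    - J x (VectorField.mlieBracket 𝓘(ℝ, E) (fun y => J y (X y)) Y x)
    - J x (VectorField.mlieBracket 𝓘(ℝ, E) X (fun y => J y (Y y)) x)
    - VectorField.mlieBracket 𝓘(ℝ, E) X Y x

end Basic

section Metric

/-- Smooth Riemannian metrics on `M`. -/
abbrev Metric (E : Type*) [NormedAddCommGroup E] [NormedSpace ℝ E]
    (M : Type*) [TopologicalSpace M] [ChartedSpace E M] [IsManifold 𝓘(ℝ, E) ∞ M] :=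
  Bundle.ContMDiffRiemannianMetric 𝓘(ℝ, E) ∞ E (fun x : M => TangentSpace 𝓘(ℝ, E) x)

variable {E : Type*} [NormedAddCommGroup E] [NormedSpace ℝ E]
  {M : Type*} [TopologicalSpace M] [ChartedSpace E M] [IsManifold 𝓘(ℝ, E) ∞ M]

/-- The vector dual to a covector: `g (sharp g x α) v = α v`. -/
def sharp (g : Metric E M) (x : M) (α : TangentSpace 𝓘(ℝ, E) x →L[ℝ] ℝ) :
    TangentSpace 𝓘(ℝ, E) x :=
  ContinuousLinearMap.inverse (g.inner x) α

/-- The coefficients `g_{ij}` of the metric in the preferred chart at `p`, as a function with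
values in the bilinear forms on the model space `E` (meaningful on the domain of that chart). -/
def chartMetric (g : Metric E M) (p : M) (x : M) : E →L[ℝ] E →L[ℝ] ℝ :=
  let e : E →L[ℝ] TangentSpace 𝓘(ℝ, E) x :=
    (trivializationAt E (TangentSpace 𝓘(ℝ, E)) p).symmL ℝ x
  (ContinuousLinearMap.precomp ℝ e) ∘L (g.inner x) ∘L e

/-- The derivative at `p` of the coefficients of the metric in the preferred chart at `p`:
`(u, v, w) ↦ ∂_u g(v, w)`. In this chart, `T_pM` is identified with `E` by the identity map. -/
def dMetric (g : Metric E M) (p : M) : E →L[ℝ] E →L[ℝ] E →L[ℝ] ℝ :=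
  mfderiv 𝓘(ℝ, E) 𝓘(ℝ, E →L[ℝ] E →L[ℝ] ℝ) (chartMetric g p) p

/-- The Christoffel symbols at `p` of the Levi-Civita connection in the preferred chart at `p`:
`g(Γ(u,v), w) = (∂_u g(v,w) + ∂_v g(u,w) - ∂_w g(u,v)) / 2`. -/
def christoffel (g : Metric E M) (p : M) (u v : TangentSpace 𝓘(ℝ, E) p) :
    TangentSpace 𝓘(ℝ, E) p :=
  sharp g p ((1 / 2 : ℝ) •
    (dMetric g p u v + dMetric g p v u - ((dMetric g p).flip u).flip v))

end Metric

section Connection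

variable {E : Type*} [NormedAddCommGroup E] [NormedSpace ℝ E]
  {M : Type*} [TopologicalSpace M] [ChartedSpace E M] [IsManifold 𝓘(ℝ, E) ∞ M]
  {F : Type*} [NormedAddCommGroup F] [NormedSpace ℝ F]
  {B : Type*} [TopologicalSpace B] [ChartedSpace F B] [IsManifold 𝓘(ℝ, F) ∞ B]

/-- The pullback to `M`, along a smooth map `f : M → B`, of the Levi-Civita connection of
`(B, g)`: the derivative at `x`, in the direction `u`, of a section `s` of `f⁻¹(TB)`. In the
preferred chart of `B` at `f x` it is `D_u s + Γ(df u, s)`. -/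
def covAlong (g : Metric F B) (f : M → B) (s : ∀ x : M, TangentSpace 𝓘(ℝ, F) (f x))
    (x : M) (u : TangentSpace 𝓘(ℝ, E) x) : TangentSpace 𝓘(ℝ, F) (f x) :=
  let ds : TangentSpace 𝓘(ℝ, F) (f x) :=
    mfderiv 𝓘(ℝ, E) 𝓘(ℝ, F)
      (fun y => (trivializationAt F (TangentSpace 𝓘(ℝ, F)) (f x)
        (Bundle.TotalSpace.mk' F (E := fun b : B => TangentSpace 𝓘(ℝ, F) b) (f y) (s y))).2) x u
  ds + christoffel g (f x) (mfderiv 𝓘(ℝ, E) 𝓘(ℝ, F) f x u) (s x)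

/-- The Levi-Civita connection `∇_X Y` of `(M, g)`. -/
def cov (g : Metric E M) (X Y : VField E M) : VField E M :=
  fun x => covAlong (M := M) (B := M) g (fun y => y) Y x (X x)

/-- The second fundamental form `(∇f_*)(X,Y) = ∇^f_X (f_* Y) - f_*(∇_X Y)` of a smooth map. -/
def secondFF (g : Metric E M) (gB : Metric F B) (f : M → B) (X Y : VField E M) (x : M) :
    TangentSpace 𝓘(ℝ, F) (f x) :=
  covAlong gB f (fun y => mfderiv 𝓘(ℝ, E) 𝓘(ℝ, F) f y (Y y)) x (X x)
    - mfderiv 𝓘(ℝ, E) 𝓘(ℝ, F) f x (cov g X Y x)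

end Connection

section Hermitian

variable {E : Type*} [NormedAddCommGroup E] [NormedSpace ℝ E]
  {M : Type*} [TopologicalSpace M] [ChartedSpace E M] [IsManifold 𝓘(ℝ, E) ∞ M]

/-- `(M, J, g)` is a Hermitian manifold: `J` is a smooth integrable almost complex structure
for which `g` is `J`-invariant. -/
structure IsHermitian (g : Metric E M) (J : EndField E M) : Prop where
  smooth : SmoothEnd J
  sq : ∀ (x : M) (v : TangentSpace 𝓘(ℝ, E) x), J x (J x v) = -v
  compat : ∀ (x : M) (u v : TangentSpace 𝓘(ℝ, E) x), g.inner x (J x u) (J x v) = g.inner x u v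
  integrable : ∀ X Y : VField E M, SmoothVF X → SmoothVF Y → ∀ x, nijenhuis J X Y x = 0

/-- The Kähler 2-form `Ω(u,v) = g(u, Jv)`. -/
def kahlerForm (g : Metric E M) (J : EndField E M) (x : M)
    (u v : TangentSpace 𝓘(ℝ, E) x) : ℝ :=
  g.inner x u (J x v)

/-- `(M, J, g)` is a locally conformal Kähler manifold with Lee form `lee`: it is Hermitian and
`lee` is a smooth closed 1-form on `M` with `dΩ = ω ∧ Ω`. -/
structure IsLCK (g : Metric E M) (J : EndField E M) (lee : OneForm E M) : Prop where
  hermitian : IsHermitian g J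
  smooth : SmoothForm lee
  closed : ∀ X Y : VField E M, SmoothVF X → SmoothVF Y → ∀ x, extDeriv₁ lee X Y x = 0
  dKahler : ∀ X Y Z : VField E M, SmoothVF X → SmoothVF Y → SmoothVF Z → ∀ x,
    extDeriv₂ (kahlerForm g J) X Y Z x =
      lee x (X x) * kahlerForm g J x (Y x) (Z x)
        - lee x (Y x) * kahlerForm g J x (X x) (Z x)
        + lee x (Z x) * kahlerForm g J x (X x) (Y x)

/-- The Lee vector field `ω^♯`. -/
def leeVector (g : Metric E M) (lee : OneForm E M) : VField E M :=
  fun x => sharp g x (lee x)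

end Hermitian

section Submersion

variable {E : Type*} [NormedAddCommGroup E] [NormedSpace ℝ E]
  {M : Type*} [TopologicalSpace M] [ChartedSpace E M] [IsManifold 𝓘(ℝ, E) ∞ M]
  {F : Type*} [NormedAddCommGroup F] [NormedSpace ℝ F]
  {B : Type*} [TopologicalSpace B] [ChartedSpace F B]

/-- The vertical space `ker π_*` at `x`. -/
def vert (pr : M → B) (x : M) : Submodule ℝ (TangentSpace 𝓘(ℝ, E) x) :=
  LinearMap.ker (mfderiv 𝓘(ℝ, E) 𝓘(ℝ, F) pr x).toLinearMap

/-- The horizontal space `(ker π_*)^⊥` at `x`. -/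
def horiz (g : Metric E M) (pr : M → B) (x : M) : Submodule ℝ (TangentSpace 𝓘(ℝ, E) x) where
  carrier := {u | ∀ v ∈ vert (F := F) pr x, g.inner x u v = 0}
  add_mem' := by
    intro a b ha hb v hv
    simp [ha v hv, hb v hv]
  zero_mem' := by
    intro v _
    simp
  smul_mem' := by
    intro c a ha v hv
    simp [ha v hv]

theorem isCompl_vert_horiz [FiniteDimensional ℝ E] (g : Metric E M) (pr : M → B) (x : M) :
    IsCompl (vert (E := E) (F := F) pr x) (horiz (F := F) g pr x) := by
  have : FiniteDimensional ℝ (TangentSpace 𝓘(ℝ, E) x) := inferInstanceAs (FiniteDimensional ℝ E)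
  let b : LinearMap.BilinForm ℝ (TangentSpace 𝓘(ℝ, E) x) :=
    LinearMap.mk₂ ℝ (fun u v => g.inner x u v) (by simp) (by simp) (by simp) (by simp)
  have hrefl : b.IsRefl := fun u v h => (g.symm x v u).trans h
  have horth : horiz (F := F) g pr x = b.orthogonal (vert (E := E) (F := F) pr x) := by
    ext u
    refine ⟨fun h v hv => (g.symm x v u).trans (h v hv), fun h v hv => (g.symm x u v).trans (h v hv)⟩
  rw [horth, LinearMap.BilinForm.isCompl_orthogonal_iff_disjoint hrefl, Submodule.disjoint_def]
  intro u hu hu'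
  by_contra hne
  exact (g.pos x u hne).ne' (hu' u hu)

/-- The projection `𝒱` onto the vertical space. -/
def vProj [FiniteDimensional ℝ E] (g : Metric E M) (pr : M → B) (x : M) :
    TangentSpace 𝓘(ℝ, E) x →ₗ[ℝ] TangentSpace 𝓘(ℝ, E) x :=
  Submodule.projection _ _ (isCompl_vert_horiz (F := F) g pr x)

/-- The projection `ℋ` onto the horizontal space. -/
def hProj [FiniteDimensional ℝ E] (g : Metric E M) (pr : M → B) (x : M) :
    TangentSpace 𝓘(ℝ, E) x →ₗ[ℝ] TangentSpace 𝓘(ℝ, E) x :=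
  Submodule.projection _ _ (isCompl_vert_horiz (F := F) g pr x).symm

/-- `pr : (M, g) → (B, gB)` is a Riemannian submersion: a smooth surjective map of maximal rank
whose differential preserves the lengths of horizontal vectors. -/
structure IsRiemannianSubmersion [IsManifold 𝓘(ℝ, F) ∞ B]
    (g : Metric E M) (gB : Metric F B) (pr : M → B) : Prop where
  smooth : ContMDiff 𝓘(ℝ, E) 𝓘(ℝ, F) ∞ pr
  surjective : Function.Surjective pr
  submersion : ∀ x : M, Function.Surjective (mfderiv 𝓘(ℝ, E) 𝓘(ℝ, F) pr x)
  isometry : ∀ (x : M), ∀ u ∈ horiz (F := F) g pr x,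
    gB.inner (pr x) (mfderiv 𝓘(ℝ, E) 𝓘(ℝ, F) pr x u) (mfderiv 𝓘(ℝ, E) 𝓘(ℝ, F) pr x u)
      = g.inner x u u

/-- A Riemannian submersion is anti-invariant if `J (ker π_*) ⊆ (ker π_*)^⊥`. -/
structure IsAntiInvariantSubmersion [IsManifold 𝓘(ℝ, F) ∞ B]
    (g : Metric E M) (J : EndField E M) (gB : Metric F B)
    (pr : M → B) : Prop extends IsRiemannianSubmersion g gB pr where
  antiInvariant : ∀ (x : M), ∀ v ∈ vert (E := E) (F := F) pr x, J x v ∈ horiz (F := F) g pr x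

/-- Smooth vertical vector fields, the elements of `Γ(ker π_*)`. -/
def IsVertical (pr : M → B) (V : VField E M) : Prop :=
  SmoothVF V ∧ ∀ x, V x ∈ vert (E := E) (F := F) pr x

/-- Smooth horizontal vector fields, the elements of `Γ((ker π_*)^⊥)`. -/
def IsHorizontal (g : Metric E M) (pr : M → B) (X : VField E M) : Prop :=
  SmoothVF X ∧ ∀ x, X x ∈ horiz (F := F) g pr x

/-- The horizontal distribution defines a totally geodesic foliation: it is involutive, and
`∇_X Y` is horizontal for all horizontal `X`, `Y` (so that its leaves are totally geodesic). -/
def HorizTotallyGeodesicFoliation (g : Metric E M) (pr : M → B) : Prop :=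
  ∀ X Y : VField E M, IsHorizontal (F := F) g pr X → IsHorizontal (F := F) g pr Y →
    ∀ x, VectorField.mlieBracket 𝓘(ℝ, E) X Y x ∈ horiz (F := F) g pr x ∧
      cov g X Y x ∈ horiz (F := F) g pr x

variable [FiniteDimensional ℝ E]

/-- O'Neill's tensor `A_X Y = ℋ ∇_{ℋX} 𝒱Y + 𝒱 ∇_{ℋX} ℋY`. -/
def oneillA (g : Metric E M) (pr : M → B) (X Y : VField E M) : VField E M := fun x =>
  hProj (F := F) g pr x
      (cov g (fun y => hProj (F := F) g pr y (X y)) (fun y => vProj (F := F) g pr y (Y y)) x)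
    + vProj (F := F) g pr x
      (cov g (fun y => hProj (F := F) g pr y (X y)) (fun y => hProj (F := F) g pr y (Y y)) x)

/-- The field `JX`. -/
def jField (J : EndField E M) (X : VField E M) : VField E M := fun x => J x (X x)

/-- The vertical part `BX` of `JX`. -/
def bPart (g : Metric E M) (J : EndField E M) (pr : M → B) (X : VField E M) : VField E M :=
  fun x => vProj (F := F) g pr x (J x (X x))

/-- The horizontal part `CX` of `JX`. -/
def cPart (g : Metric E M) (J : EndField E M) (pr : M → B) (X : VField E M) : VField E M :=
  fun x => hProj (F := F) g pr x (J x (X x))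

end Submersion

end LCK

end

/-! Everything rests on one pointwise identity, `IsAntiInvariantSubmersion.inner_cov_horizontal`:
for horizontal X, Y and vertical V, g(∇_X Y, V) is the left side of (b) minus its right side.
Pairing with vertical fields detects whether ∇_X Y is horizontal, and involutivity is then automatic
since [X,Y] = ∇_X Y − ∇_Y X (`horizTotallyGeodesicFoliation_iff`). Hence (a) ⇔ (b).

The identity holds because dΩ = ω ∧ Ω and integrability determine ∇J (`IsLCK.nablaJ_eq`): 2g((∇_X
J)Y, Z) = ω(JY)g(X,Z) − ω(JZ)g(X,Y) + ω(Y)g(X,JZ) − ω(Z)g(X,JY). So g(∇_X Y, V) equals g(∇_X JY, JV)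
up to Lee terms. Split JY = BY + CY. The BY part gives A_X BY. Since CY ⊥ J(ker π_*), the derivative
moves from CY to JV, and a second use of the formula turns ∇_X JV into J∇_X V, paired with CY. A
vertical Lee field makes ω vanish on horizontal vectors, which removes the other Lee terms.

For (b) ⇔ (c), the second fundamental form of a Riemannian submersion vanishes on horizontal pairs
(`IsRiemannianSubmersion.inner_secondFF_horizontal`) and π_* kills BY. Thus (∇π_*)(X,JY) = −π_*(∇_X
BY), whose product with π_*JV is −g(A_X BY, JV).

The connection is given by Christoffel symbols, so metric compatibility (`vderiv_inner`) and
torsion-freeness (`covAlong_mfderiv_sub`) are proved in charts, for pullback connections. Smoothness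
of BY and CY comes from `SmoothVF.hProj`. -/

noncomputable section

namespace LCK

open Bundle Filter Topology VectorField

/-! ### Lie brackets as commutators of derivations on vector-valued functions. -/

section Bracket

variable {E : Type*} [NormedAddCommGroup E] [NormedSpace ℝ E]
  {M : Type*} [TopologicalSpace M] [ChartedSpace E M]
  {G : Type*} [NormedAddCommGroup G] [NormedSpace ℝ G]

/-- The derivative at `x` of a vector-valued function, computed in the preferred chart at `x`. -/
theorem mfderiv_eq_fderiv_chart {k : M → G} {x : M} (hk : MDifferentiableAt 𝓘(ℝ, E) 𝓘(ℝ, G) k x) :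
    mfderiv 𝓘(ℝ, E) 𝓘(ℝ, G) k x =
      fderiv ℝ (k ∘ (extChartAt 𝓘(ℝ, E) x).symm) (extChartAt 𝓘(ℝ, E) x x) := by
  rw [hk.mfderiv]
  simp [writtenInExtChartAt, fderivWithin_univ]
  rfl

/-- The derivative `X k` of a vector-valued function along a vector field. -/
def vecDeriv (X : VField E M) (k : M → G) : M → G :=
  fun y => mfderiv 𝓘(ℝ, E) 𝓘(ℝ, G) k y (X y)

/-- The expression of a vector field in the preferred chart at `x`. -/
def fieldInChart (x : M) (X : VField E M) : E → E :=
  mpullbackWithin 𝓘(ℝ, E) 𝓘(ℝ, E) (extChartAt 𝓘(ℝ, E) x).symm X (Set.range 𝓘(ℝ, E))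

variable [IsManifold 𝓘(ℝ, E) ∞ M]

theorem differentiableAt_fieldInChart [CompleteSpace E] {X : VField E M} (hX : SmoothVF X)
    (x : M) : DifferentiableAt ℝ (fieldInChart x X) (extChartAt 𝓘(ℝ, E) x x) := by
  have h := contMDiffWithinAt_mpullbackWithin_extChartAt_symm (I := 𝓘(ℝ, E)) (n := ∞) (m := 1)
    (s := Set.univ) (x := x) ((hX x).of_le (by simp)).contMDiffWithinAt
    uniqueMDiffOn_univ (Set.mem_univ x) (by norm_cast)
  rw [contMDiffWithinAt_vectorSpace_iff_contDiffWithinAt] at h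
  refine (h.differentiableWithinAt one_ne_zero).differentiableAt ?_
  simp only [Set.preimage_univ, Set.inter_univ]
  exact extChartAt_target_mem_nhds x

theorem fieldInChart_self (x : M) (X : VField E M) :
    fieldInChart x X (extChartAt 𝓘(ℝ, E) x x) = X x := by
  -- The round trip through the chart returns x only up to a propositional equality, on which the
  -- type of the fibre depends; hence the generalization to y.
  have h : ∀ (y : M), y = x →
      ContinuousLinearMap.inverse (mfderivWithin 𝓘(ℝ, E) 𝓘(ℝ, E) (extChartAt 𝓘(ℝ, E) x).symm
        (Set.range 𝓘(ℝ, E)) (extChartAt 𝓘(ℝ, E) x x) : E →L[ℝ] E) (X y) = (X x : E) := by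
    rintro _ rfl
    exact mfderivWithin_extChartAt_symm_inverse_apply _
  exact h _ (extChartAt_to_inv x)

/-- The manifold bracket is the chart bracket pulled back by the derivative of the chart, and that
derivative is the identity at the base point of the preferred chart. -/
theorem mlieBracket_eq_lieBracket_chart (X Y : VField E M) (x : M) :
    mlieBracket 𝓘(ℝ, E) X Y x =
      lieBracket ℝ (fieldInChart x X) (fieldInChart x Y) (extChartAt 𝓘(ℝ, E) x x) := by
  have h : mfderiv 𝓘(ℝ, E) 𝓘(ℝ, E) (extChartAt 𝓘(ℝ, E) x) x = ContinuousLinearMap.id ℝ E :=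
    mfderiv_extChartAt_self
  have h' : ContinuousLinearMap.inverse
      (mfderiv 𝓘(ℝ, E) 𝓘(ℝ, E) (extChartAt 𝓘(ℝ, E) x) x : E →L[ℝ] E) =
      ContinuousLinearMap.id ℝ E := (congrArg _ h).trans ContinuousLinearMap.inverse_id
  refine (congrArg (fun L : E →L[ℝ] E => L (lieBracketWithin ℝ (fieldInChart x X)
    (fieldInChart x Y) ((extChartAt 𝓘(ℝ, E) x).symm ⁻¹' Set.univ ∩ Set.range 𝓘(ℝ, E))
    (extChartAt 𝓘(ℝ, E) x x))) h').trans ?_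
  simp

/-- In the preferred chart at `x`, the function `X k` is the derivative of `k` along `X`. -/
theorem eventuallyEq_vecDeriv_chart {k : M → G} {x : M}
    (hk : ContMDiffAt 𝓘(ℝ, E) 𝓘(ℝ, G) ∞ k x) (X : VField E M) :
    (vecDeriv X k ∘ (extChartAt 𝓘(ℝ, E) x).symm) =ᶠ[𝓝 (extChartAt 𝓘(ℝ, E) x x)]
      (fun z => fderiv ℝ (k ∘ (extChartAt 𝓘(ℝ, E) x).symm) z (fieldInChart x X z)) := by
  have hk1 : ∀ᶠ y in 𝓝 x, ContMDiffAt 𝓘(ℝ, E) 𝓘(ℝ, G) 1 k y :=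
    (contMDiffAt_iff_contMDiffAt_nhds (by simp)).1 (hk.of_le (by simp))
  have hc : Tendsto (extChartAt 𝓘(ℝ, E) x).symm (𝓝 (extChartAt 𝓘(ℝ, E) x x)) (𝓝 x) := by
    have := continuousAt_extChartAt_symm (I := 𝓘(ℝ, E)) x
    rwa [ContinuousAt, extChartAt_to_inv] at this
  filter_upwards [extChartAt_target_mem_nhds (I := 𝓘(ℝ, E)) x, hc.eventually hk1] with z hz hkz
  have h1 : MDifferentiableAt 𝓘(ℝ, E) 𝓘(ℝ, E) (extChartAt 𝓘(ℝ, E) x).symm z := by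
    have := mdifferentiableWithinAt_extChartAt_symm (I := 𝓘(ℝ, E)) hz
    rwa [modelWithCornersSelf_coe, Set.range_id, mdifferentiableWithinAt_univ] at this
  have h2 := isInvertible_mfderivWithin_extChartAt_symm (I := 𝓘(ℝ, E)) hz
  have h3 : (mfderiv 𝓘(ℝ, E) 𝓘(ℝ, E) (extChartAt 𝓘(ℝ, E) x).symm z : E →L[ℝ] E)
      (fieldInChart (E := E) x X z) = X ((extChartAt 𝓘(ℝ, E) x).symm z) := by
    refine Eq.trans ?_ (h2.self_apply_inverse _)
    simp only [fieldInChart, mpullbackWithin, modelWithCornersSelf_coe, Set.range_id,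
      mfderivWithin_univ]
  rw [← mfderiv_eq_fderiv, mfderiv_comp z (hkz.mdifferentiableAt one_ne_zero) h1]
  exact (congrArg (mfderiv 𝓘(ℝ, E) 𝓘(ℝ, G) k ((extChartAt 𝓘(ℝ, E) x).symm z)) h3).symm

theorem mdifferentiableAt_vecDeriv [CompleteSpace E] {k : M → G} {x : M}
    (hk : ContMDiffAt 𝓘(ℝ, E) 𝓘(ℝ, G) ∞ k x) {X : VField E M} (hX : SmoothVF X) :
    MDifferentiableAt 𝓘(ℝ, E) 𝓘(ℝ, G) (vecDeriv X k) x := by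
  have := ContMDiffAt.clm_apply_of_inCoordinates (n := 1) (IB₁ := 𝓘(ℝ, E)) (IB₂ := 𝓘(ℝ, G))
    (hk.mfderiv_const (m := 1) (by norm_cast)) ((hX x).of_le (by simp)) (hk.of_le (by simp))
  exact ((contMDiff_snd_tangentBundle_modelSpace G 𝓘(ℝ, G)).contMDiffAt.comp x
    this).mdifferentiableAt one_ne_zero

/-- The derivative of a vector-valued function along `[X, Y]` is the commutator of the
derivatives along `X` and `Y`. -/
theorem vecDeriv_mlieBracket [CompleteSpace E] {k : M → G} {x : M}
    (hk : ContMDiffAt 𝓘(ℝ, E) 𝓘(ℝ, G) ∞ k x) {X Y : VField E M}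
    (hX : SmoothVF X) (hY : SmoothVF Y) :
    vecDeriv (mlieBracket 𝓘(ℝ, E) X Y) k x =
      vecDeriv X (vecDeriv Y k) x - vecDeriv Y (vecDeriv X k) x := by
  have hkc : ContDiffAt ℝ ∞ (k ∘ (extChartAt 𝓘(ℝ, E) x).symm) (extChartAt 𝓘(ℝ, E) x x) := by
    have := (contMDiffAt_iff.1 hk).2
    simp only [modelWithCornersSelf_coe, Set.range_id, contDiffWithinAt_univ] at this
    exact this
  have hval : ∀ (Z : VField E M) (l : M → G), MDifferentiableAt 𝓘(ℝ, E) 𝓘(ℝ, G) l x →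
      vecDeriv Z l x = fderiv ℝ (l ∘ (extChartAt 𝓘(ℝ, E) x).symm) (extChartAt 𝓘(ℝ, E) x x)
        (fieldInChart x Z (extChartAt 𝓘(ℝ, E) x x)) := by
    intro Z l hl
    rw [vecDeriv, fieldInChart_self, mfderiv_eq_fderiv_chart hl]
    rfl
  rw [hval _ _ (hk.mdifferentiableAt (by simp)), fieldInChart_self,
    mlieBracket_eq_lieBracket_chart, hval _ _ (mdifferentiableAt_vecDeriv hk hX),
    hval _ _ (mdifferentiableAt_vecDeriv hk hY), (eventuallyEq_vecDeriv_chart hk X).fderiv_eq,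
    (eventuallyEq_vecDeriv_chart hk Y).fderiv_eq]
  -- In the chart, the claim is the symmetry of the second derivative of k.
  exact fderiv_apply_lieBracket hkc (by simpa using ENat.LEInfty.out)
    (differentiableAt_fieldInChart hY x) (differentiableAt_fieldInChart hX x)

end Bracket

/-! ### Product and sum rules for vector-valued functions on a manifold. -/

section Calculus

variable {E : Type*} [NormedAddCommGroup E] [NormedSpace ℝ E]
  {M : Type*} [TopologicalSpace M] [ChartedSpace E M]
  {G : Type*} [NormedAddCommGroup G] [NormedSpace ℝ G]
  {G₁ : Type*} [NormedAddCommGroup G₁] [NormedSpace ℝ G₁]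
  {G₂ : Type*} [NormedAddCommGroup G₂] [NormedSpace ℝ G₂]

variable (E) in
/-- The derivative of a vector-valued function, with values in the space itself. -/
def vderiv (k : M → G) (x : M) : E →L[ℝ] G := mfderiv 𝓘(ℝ, E) 𝓘(ℝ, G) k x

theorem vderiv_eq_fderiv_chart {k : M → G} {x : M} (hk : MDifferentiableAt 𝓘(ℝ, E) 𝓘(ℝ, G) k x) :
    vderiv E k x = fderiv ℝ (k ∘ (extChartAt 𝓘(ℝ, E) x).symm) (extChartAt 𝓘(ℝ, E) x x) :=
  mfderiv_eq_fderiv_chart hk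

theorem differentiableAt_chart {k : M → G} {x : M}
    (hk : MDifferentiableAt 𝓘(ℝ, E) 𝓘(ℝ, G) k x) :
    DifferentiableAt ℝ (k ∘ (extChartAt 𝓘(ℝ, E) x).symm) (extChartAt 𝓘(ℝ, E) x x) := by
  have := (mdifferentiableAt_iff _ _ |>.1 hk).2
  simp only [modelWithCornersSelf_coe, Set.range_id, differentiableWithinAt_univ] at this
  exact this

theorem vderiv_clm_apply {A : M → G₁ →L[ℝ] G} {a : M → G₁} {x : M}
    (hA : MDifferentiableAt 𝓘(ℝ, E) 𝓘(ℝ, G₁ →L[ℝ] G) A x)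
    (ha : MDifferentiableAt 𝓘(ℝ, E) 𝓘(ℝ, G₁) a x) (u : E) :
    vderiv E (fun y => A y (a y)) x u = vderiv E A x u (a x) + A x (vderiv E a x u) := by
  have h := fderiv_clm_apply (differentiableAt_chart hA) (differentiableAt_chart ha)
  rw [vderiv_eq_fderiv_chart (hA.clm_apply ha), vderiv_eq_fderiv_chart hA,
    vderiv_eq_fderiv_chart ha]
  have h2 : ((fun y => A y (a y)) ∘ (extChartAt 𝓘(ℝ, E) x).symm) =
    fun z => (A ∘ (extChartAt 𝓘(ℝ, E) x).symm) z ((a ∘ (extChartAt 𝓘(ℝ, E) x).symm) z) := rfl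
  rw [h2, h]
  simp only [add_apply, ContinuousLinearMap.comp_apply,
    ContinuousLinearMap.flip_apply, Function.comp_apply, extChartAt_to_inv]
  exact add_comm _ _

theorem vderiv_clm_apply₂ {A : M → G₁ →L[ℝ] G₂ →L[ℝ] G} {a : M → G₁} {b : M → G₂} {x : M}
    (hA : MDifferentiableAt 𝓘(ℝ, E) 𝓘(ℝ, G₁ →L[ℝ] G₂ →L[ℝ] G) A x)
    (ha : MDifferentiableAt 𝓘(ℝ, E) 𝓘(ℝ, G₁) a x)
    (hb : MDifferentiableAt 𝓘(ℝ, E) 𝓘(ℝ, G₂) b x) (u : E) :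
    vderiv E (fun y => A y (a y) (b y)) x u =
      vderiv E A x u (a x) (b x) + A x (vderiv E a x u) (b x) + A x (a x) (vderiv E b x u) := by
  rw [vderiv_clm_apply (hA.clm_apply ha) hb, vderiv_clm_apply hA ha,
    add_apply]

theorem vderiv_add {a b : M → G} {x : M} (ha : MDifferentiableAt 𝓘(ℝ, E) 𝓘(ℝ, G) a x)
    (hb : MDifferentiableAt 𝓘(ℝ, E) 𝓘(ℝ, G) b x) :
    vderiv E (fun y => a y + b y) x = vderiv E a x + vderiv E b x :=
  mfderiv_add ha hb

theorem vderiv_neg (a : M → G) (x : M) :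
    vderiv E (fun y => - a y) x = - vderiv E a x :=
  mfderiv_neg

end Calculus

/-! ### The metric in charts, and the Christoffel symbols. -/

section Metric

variable {E : Type*} [NormedAddCommGroup E] [NormedSpace ℝ E]

/-- A definite bilinear form on a finite-dimensional space is nondegenerate. -/
theorem isInvertible_of_definite [FiniteDimensional ℝ E] (L : E →L[ℝ] E →L[ℝ] ℝ)
    (hL : ∀ v, L v v = 0 → v = 0) : L.IsInvertible := by
  have hinj : Function.Injective L := by
    rw [injective_iff_map_eq_zero]
    intro v hv
    exact hL v (by rw [hv]; rfl)
  have hdim : Module.finrank ℝ E = Module.finrank ℝ (E →L[ℝ] ℝ) := by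
    rw [← Subspace.dual_finrank_eq (K := ℝ) (V := E)]
    exact LinearEquiv.finrank_eq LinearMap.toContinuousLinearMap
  exact ⟨(LinearMap.linearEquivOfInjective (L : E →ₗ[ℝ] E →L[ℝ] ℝ) hinj
    hdim).toContinuousLinearEquiv, by ext; rfl⟩

variable {M : Type*} [TopologicalSpace M] [ChartedSpace E M] [IsManifold 𝓘(ℝ, E) ∞ M]

/-- Definiteness makes g_x invertible in finite dimension, so `ContinuousLinearMap.inverse` is a
true inverse and not its default value 0. -/
theorem inner_sharp [FiniteDimensional ℝ E] (g : Metric E M) (x : M)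
    (α : TangentSpace 𝓘(ℝ, E) x →L[ℝ] ℝ) (v : TangentSpace 𝓘(ℝ, E) x) :
    g.inner x (sharp g x α) v = α v := by
  have h : (g.inner x).IsInvertible := isInvertible_of_definite (E := E) (g.inner x) (by
    intro v hv
    by_contra hne
    exact (g.pos x v hne).ne' hv)
  rw [sharp, h.self_apply_inverse]

theorem inner_ext (g : Metric E M) {x : M} {u v : TangentSpace 𝓘(ℝ, E) x}
    (h : ∀ w, g.inner x u w = g.inner x v w) : u = v := by
  by_contra hne
  have := g.pos x (u - v) (sub_ne_zero.2 hne)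
  have h' : g.inner x (u - v) (u - v) = g.inner x u (u - v) - g.inner x v (u - v) := by
    exact congrArg (fun L => L (u - v)) (map_sub (g.inner x) u v)
  linarith [h (u - v)]

/-- The components of a tangent vector at `y` in the preferred chart at `p`. -/
def coord (p : M) {y : M} (v : TangentSpace 𝓘(ℝ, E) y) : E :=
  (trivializationAt E (TangentSpace 𝓘(ℝ, E)) p
    (TotalSpace.mk' E (E := fun b : M => TangentSpace 𝓘(ℝ, E) b) y v)).2

theorem coord_self (p : M) (v : TangentSpace 𝓘(ℝ, E) p) : coord p v = v :=
  (tangentBundleCore 𝓘(ℝ, E) M).coordChange_self (achart E p) p (mem_achart_source E p) v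

theorem coord_eq_continuousLinearMapAt {p y : M} (hy : y ∈ (chartAt E p).source)
    (v : TangentSpace 𝓘(ℝ, E) y) :
    coord p v = (trivializationAt E (TangentSpace 𝓘(ℝ, E)) p).continuousLinearMapAt ℝ y v :=
  ((trivializationAt E (TangentSpace 𝓘(ℝ, E)) p).continuousLinearMapAt_apply_of_mem
    (R := ℝ) (b := y) hy v).symm

theorem symmL_coord {p y : M} (hy : y ∈ (chartAt E p).source) (v : TangentSpace 𝓘(ℝ, E) y) :
    (trivializationAt E (TangentSpace 𝓘(ℝ, E)) p).symmL ℝ y (coord p v) = v := by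
  rw [coord_eq_continuousLinearMapAt hy]
  exact (trivializationAt E (TangentSpace 𝓘(ℝ, E)) p).symmL_continuousLinearMapAt hy v

theorem chartMetric_apply (g : Metric E M) (p y : M) (v w : E) :
    chartMetric g p y v w = g.inner y
      ((trivializationAt E (TangentSpace 𝓘(ℝ, E)) p).symmL ℝ y v)
      ((trivializationAt E (TangentSpace 𝓘(ℝ, E)) p).symmL ℝ y w) := rfl

theorem chartMetric_coord (g : Metric E M) {p y : M} (hy : y ∈ (chartAt E p).source)
    (v w : TangentSpace 𝓘(ℝ, E) y) :
    chartMetric g p y (coord p v) (coord p w) = g.inner y v w := by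
  rw [chartMetric_apply, symmL_coord hy, symmL_coord hy]

theorem chartMetric_self (g : Metric E M) (p : M) (v w : TangentSpace 𝓘(ℝ, E) p) :
    chartMetric g p p v w = g.inner p v w := by
  have h := chartMetric_coord g (mem_chart_source E p) v w
  rw [coord_self, coord_self] at h
  exact h

theorem chartMetric_symm (g : Metric E M) (p y : M) (v w : E) :
    chartMetric g p y v w = chartMetric g p y w v := by
  rw [chartMetric_apply, chartMetric_apply, g.symm]

/-- On the chart domain these coefficients are the bundle coordinates of g, regarded as a smooth
section of the bundle of bilinear forms. -/
theorem contMDiffAt_chartMetric (g : Metric E M) (p : M) :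
    ContMDiffAt 𝓘(ℝ, E) 𝓘(ℝ, E →L[ℝ] E →L[ℝ] ℝ) ∞ (chartMetric g p) p := by
  have h := (contMDiffAt_hom_bundle _).1 (g.contMDiff.contMDiffAt (x := p))
  refine h.2.congr_of_eventuallyEq ?_
  filter_upwards [(chartAt E p).open_source.mem_nhds (mem_chart_source E p)] with y hy
  ext v w
  refine Eq.trans ?_ (inCoordinates_apply_eq₂ (𝕜 := ℝ) (F₁ := E) (F₂ := E)
    (F₃ := ℝ) (E₁ := fun x : M => TangentSpace 𝓘(ℝ, E) x)
    (E₂ := fun x : M => TangentSpace 𝓘(ℝ, E) x) (E₃ := Bundle.Trivial M ℝ) hy hy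
    (Set.mem_univ _)).symm
  rw [chartMetric_apply, Trivialization.symmL_apply _ hy, Trivialization.symmL_apply _ hy]
  simp

/-- The coefficients are symmetric at every point, so the symmetry passes to their derivative. -/
theorem dMetric_symm (g : Metric E M) (p : M) (u v w : E) :
    dMetric g p u v w = dMetric g p u w v := by
  have hA := (contMDiffAt_chartMetric g p).mdifferentiableAt (by simp)
  have hc : ∀ c : E, MDifferentiableAt 𝓘(ℝ, E) 𝓘(ℝ, E) (fun _ : M => c) p :=
    fun c => mdifferentiableAt_const
  have h0 : ∀ c : E, vderiv E (fun _ : M => c) p u = 0 := fun c => by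
    have : vderiv E (fun _ : M => c) p = 0 := mfderiv_const
    rw [this]; rfl
  have h : ∀ a b : E, vderiv E (fun y => chartMetric g p y a b) p u = dMetric g p u a b := by
    intro a b
    rw [vderiv_clm_apply₂ hA (hc a) (hc b), h0, h0]
    simp only [map_zero, zero_apply, add_zero]
    rfl
  rw [← h, ← h]
  simp only [chartMetric_symm g p _ v w]

/-- The derivative at `p` of the coefficients of the metric, as a function of tangent vectors. -/
def dInner (g : Metric E M) (p : M) (u v w : TangentSpace 𝓘(ℝ, E) p) : ℝ := dMetric g p u v w

theorem dInner_symm (g : Metric E M) (p : M) (u v w : TangentSpace 𝓘(ℝ, E) p) :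
    dInner g p u v w = dInner g p u w v :=
  dMetric_symm g p u v w

theorem dInner_add_left (g : Metric E M) (p : M) (u u' v w : TangentSpace 𝓘(ℝ, E) p) :
    dInner g p (u + u') v w = dInner g p u v w + dInner g p u' v w :=
  congrArg (fun L : E →L[ℝ] E →L[ℝ] ℝ => L v w) ((dMetric g p).map_add u u')

theorem dInner_add_right (g : Metric E M) (p : M) (u v w w' : TangentSpace 𝓘(ℝ, E) p) :
    dInner g p u v (w + w') = dInner g p u v w + dInner g p u v w' :=
  (dMetric g p u v : E →L[ℝ] ℝ).map_add w w'

theorem dInner_neg_left (g : Metric E M) (p : M) (u v w : TangentSpace 𝓘(ℝ, E) p) :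
    dInner g p (-u) v w = -dInner g p u v w := by
  have h := dInner_add_left g p u (-u) v w
  have h0 := dInner_add_left g p 0 0 v w
  rw [add_neg_cancel] at h
  rw [add_zero] at h0
  linarith

theorem dInner_neg_right (g : Metric E M) (p : M) (u v w : TangentSpace 𝓘(ℝ, E) p) :
    dInner g p u v (-w) = -dInner g p u v w :=
  (dMetric g p u v : E →L[ℝ] ℝ).map_neg w

theorem inner_christoffel [FiniteDimensional ℝ E] (g : Metric E M) (p : M)
    (u v w : TangentSpace 𝓘(ℝ, E) p) :
    g.inner p (christoffel g p u v) w =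
      1 / 2 * (dInner g p u v w + dInner g p v u w - dInner g p w u v) :=
  inner_sharp g p _ w

theorem christoffel_symm [FiniteDimensional ℝ E] (g : Metric E M) (p : M)
    (u v : TangentSpace 𝓘(ℝ, E) p) : christoffel g p u v = christoffel g p v u := by
  refine inner_ext g fun w => ?_
  rw [inner_christoffel, inner_christoffel, dInner_symm g p w u v]
  ring

theorem inner_add_left (g : Metric E M) {p : M} (u v w : TangentSpace 𝓘(ℝ, E) p) :
    g.inner p (u + v) w = g.inner p u w + g.inner p v w :=
  congrArg (fun L => L w) (map_add (g.inner p) u v)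

theorem inner_neg_left (g : Metric E M) {p : M} (u w : TangentSpace 𝓘(ℝ, E) p) :
    g.inner p (-u) w = -g.inner p u w :=
  congrArg (fun L => L w) (map_neg (g.inner p) u)

theorem inner_sub_left (g : Metric E M) {p : M} (u v w : TangentSpace 𝓘(ℝ, E) p) :
    g.inner p (u - v) w = g.inner p u w - g.inner p v w := by
  rw [sub_eq_add_neg, inner_add_left, inner_neg_left, sub_eq_add_neg]

theorem inner_add_right (g : Metric E M) {p : M} (u v w : TangentSpace 𝓘(ℝ, E) p) :
    g.inner p u (v + w) = g.inner p u v + g.inner p u w :=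
  map_add (g.inner p u) v w

theorem inner_neg_right (g : Metric E M) {p : M} (u v : TangentSpace 𝓘(ℝ, E) p) :
    g.inner p u (-v) = -g.inner p u v :=
  map_neg (g.inner p u) v

theorem christoffel_add [FiniteDimensional ℝ E] (g : Metric E M) (p : M)
    (u v v' : TangentSpace 𝓘(ℝ, E) p) :
    christoffel g p u (v + v') = christoffel g p u v + christoffel g p u v' := by
  refine inner_ext g fun w => ?_
  rw [inner_add_left, inner_christoffel, inner_christoffel, inner_christoffel, dInner_add_left,
    dInner_add_right, dInner_symm g p u (v + v') w, dInner_add_right, dInner_symm g p u w v,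
    dInner_symm g p u w v']
  ring

theorem christoffel_neg [FiniteDimensional ℝ E] (g : Metric E M) (p : M)
    (u v : TangentSpace 𝓘(ℝ, E) p) : christoffel g p u (-v) = -christoffel g p u v := by
  refine inner_ext g fun w => ?_
  rw [inner_neg_left, inner_christoffel, inner_christoffel, dInner_neg_left,
    dInner_neg_right, dInner_symm g p u (-v) w, dInner_neg_right, dInner_symm g p u w v]
  ring

end Metric

/-! ### The pullback connection: metric compatibility and torsion-freeness. -/

section Connection

variable {E : Type*} [NormedAddCommGroup E] [NormedSpace ℝ E]
  {M : Type*} [TopologicalSpace M] [ChartedSpace E M]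
  {F : Type*} [NormedAddCommGroup F] [NormedSpace ℝ F]
  {B : Type*} [TopologicalSpace B] [ChartedSpace F B] [IsManifold 𝓘(ℝ, F) ∞ B]

variable (E) in
/-- Differentiability at `x` of a section of the pullback `f⁻¹(TB)`. -/
def MDiffAlongAt (f : M → B) (s : ∀ x : M, TangentSpace 𝓘(ℝ, F) (f x)) (x : M) : Prop :=
  MDifferentiableAt 𝓘(ℝ, E) (𝓘(ℝ, F).prod 𝓘(ℝ, F))
    (fun y => TotalSpace.mk' F (E := fun b : B => TangentSpace 𝓘(ℝ, F) b) (f y) (s y)) x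

variable {f : M → B} {s t : ∀ x : M, TangentSpace 𝓘(ℝ, F) (f x)} {x : M}

theorem MDiffAlongAt.base (hs : MDiffAlongAt E f s x) :
    MDifferentiableAt 𝓘(ℝ, E) 𝓘(ℝ, F) f x :=
  ((mdifferentiableAt_totalSpace _ _).1 hs).1

theorem MDiffAlongAt.coord (hs : MDiffAlongAt E f s x) :
    MDifferentiableAt 𝓘(ℝ, E) 𝓘(ℝ, F) (fun y => LCK.coord (f x) (s y)) x :=
  ((mdifferentiableAt_totalSpace _ _).1 hs).2

omit [NormedSpace ℝ F] [IsManifold 𝓘(ℝ, F) ∞ B] in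
theorem eventually_mem_chart_source {f : M → B} {x : M} (hf : ContinuousAt f x) :
    ∀ᶠ y in 𝓝 x, f y ∈ (chartAt F (f x)).source :=
  hf ((chartAt F (f x)).open_source.mem_nhds (mem_chart_source F (f x)))

theorem vderiv_congr {G : Type*} [NormedAddCommGroup G] [NormedSpace ℝ G] {k l : M → G} {x : M}
    (h : k =ᶠ[𝓝 x] l) : vderiv E k x = vderiv E l x :=
  h.mfderiv_eq

/-- The derivative at `x` of the components of a section of `f⁻¹(TB)`, in the preferred chart. -/
def coordDeriv (f : M → B) (s : ∀ x : M, TangentSpace 𝓘(ℝ, F) (f x)) (x : M)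
    (u : TangentSpace 𝓘(ℝ, E) x) : TangentSpace 𝓘(ℝ, F) (f x) :=
  vderiv E (fun y => coord (f x) (s y)) x u

theorem covAlong_eq (g : Metric F B) (f : M → B) (s : ∀ x : M, TangentSpace 𝓘(ℝ, F) (f x))
    (x : M) (u : TangentSpace 𝓘(ℝ, E) x) :
    covAlong g f s x u = coordDeriv f s x u
      + christoffel g (f x) (mfderiv 𝓘(ℝ, E) 𝓘(ℝ, F) f x u) (s x) := rfl

/-- Product rule for the chart expression g_{ij} s^i t^j. The Christoffel symbols do not enter yet;
they later absorb the term in the derivative of g_{ij}. -/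
theorem vderiv_inner_coordDeriv (g : Metric F B)
    (hs : MDiffAlongAt E f s x) (ht : MDiffAlongAt E f t x) (u : TangentSpace 𝓘(ℝ, E) x) :
    vderiv E (fun y => g.inner (f y) (s y) (t y)) x u =
      dInner g (f x) (mfderiv 𝓘(ℝ, E) 𝓘(ℝ, F) f x u) (s x) (t x)
      + g.inner (f x) (coordDeriv f s x u) (t x) + g.inner (f x) (s x) (coordDeriv f t x u) := by
  have hA := (contMDiffAt_chartMetric g (f x)).mdifferentiableAt (by simp)
  have hAf : MDifferentiableAt 𝓘(ℝ, E) 𝓘(ℝ, F →L[ℝ] F →L[ℝ] ℝ)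
      (fun y => chartMetric g (f x) (f y)) x := hA.comp x hs.base
  have hd : vderiv E (fun y => chartMetric g (f x) (f y)) x u =
      dMetric g (f x) (mfderiv 𝓘(ℝ, E) 𝓘(ℝ, F) f x u) :=
    congrArg (fun L => L u) (mfderiv_comp x hA hs.base)
  have hev : (fun y => g.inner (f y) (s y) (t y)) =ᶠ[𝓝 x]
      fun y => chartMetric g (f x) (f y) (coord (f x) (s y)) (coord (f x) (t y)) := by
    filter_upwards [eventually_mem_chart_source (F := F) hs.base.continuousAt] with y hy
    exact (chartMetric_coord g hy _ _).symm
  refine (congrArg (fun L : E →L[ℝ] ℝ => L u) (vderiv_congr hev)).trans ?_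
  refine (vderiv_clm_apply₂ hAf hs.coord ht.coord u).trans ?_
  have hsx : coord (f x) (s x) = (s x : F) := coord_self _ _
  have htx : coord (f x) (t x) = (t x : F) := coord_self _ _
  refine congrArg₂ (· + ·) (congrArg₂ (· + ·) ?_ ?_) ?_
  · exact (congrArg (fun L : F →L[ℝ] F →L[ℝ] ℝ => L (coord (f x) (s x)) (coord (f x) (t x)))
      hd).trans (congrArg₂ (fun a b : F => (dMetric g (f x) (mfderiv 𝓘(ℝ, E) 𝓘(ℝ, F) f x u)) a b)
        hsx htx)
  · exact (congrArg (fun a : F => chartMetric g (f x) (f x) _ a) htx).trans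
      (chartMetric_self g (f x) (coordDeriv f s x u) (t x))
  · exact (congrArg (fun a : F => chartMetric g (f x) (f x) a _) hsx).trans
      (chartMetric_self g (f x) (s x) (coordDeriv f t x u))

/-- The pullback connection is compatible with the metric. -/
theorem vderiv_inner [FiniteDimensional ℝ F] (g : Metric F B) (hs : MDiffAlongAt E f s x)
    (ht : MDiffAlongAt E f t x) (u : TangentSpace 𝓘(ℝ, E) x) :
    vderiv E (fun y => g.inner (f y) (s y) (t y)) x u =
      g.inner (f x) (covAlong g f s x u) (t x) + g.inner (f x) (s x) (covAlong g f t x u) := by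
  rw [vderiv_inner_coordDeriv g hs ht, covAlong_eq, covAlong_eq, inner_add_left,
    inner_christoffel, g.symm (f x) (s x) (_ + _), inner_add_left, inner_christoffel,
    g.symm (f x) (s x), dInner_symm g (f x) (mfderiv 𝓘(ℝ, E) 𝓘(ℝ, F) f x u) (t x) (s x)]
  ring

variable [IsManifold 𝓘(ℝ, E) ∞ M]

theorem mdiffAlongAt_mfderiv {X : VField E M} (hf : ContMDiff 𝓘(ℝ, E) 𝓘(ℝ, F) ∞ f)
    (hX : SmoothVF X) (x : M) :
    MDiffAlongAt E f (fun y => mfderiv 𝓘(ℝ, E) 𝓘(ℝ, F) f y (X y)) x :=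
  (((hf.contMDiff_tangentMap (m := 1) (by norm_cast)).comp
    (hX.of_le (by simp))).mdifferentiable one_ne_zero) x

omit [IsManifold 𝓘(ℝ, E) ∞ M] in
-- The trivialization of TB is the derivative of the chart, so this is the chain rule. It reduces
-- torsion-freeness to the commutator formula for the vector-valued function "chart ∘ f".
theorem coord_mfderiv_eventuallyEq (hf : ContMDiff 𝓘(ℝ, E) 𝓘(ℝ, F) ∞ f) (X : VField E M) (x : M) :
    (fun y => coord (f x) (mfderiv 𝓘(ℝ, E) 𝓘(ℝ, F) f y (X y))) =ᶠ[𝓝 x]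
      vecDeriv X (extChartAt 𝓘(ℝ, F) (f x) ∘ f) := by
  filter_upwards [eventually_mem_chart_source (F := F) (hf.continuous.continuousAt (x := x))]
    with y hy
  rw [coord_eq_continuousLinearMapAt hy]
  have h1 := TangentBundle.continuousLinearMapAt_trivializationAt (I := 𝓘(ℝ, F)) hy
  have h2 := mfderiv_comp y (mdifferentiableAt_extChartAt (I := 𝓘(ℝ, F)) hy)
    (hf.mdifferentiable (by simp) y)
  rw [h1]
  exact (congrArg (fun L => L (X y)) h2).symm

/-- The pullback connection is torsion-free. -/
theorem covAlong_mfderiv_sub [FiniteDimensional ℝ F] [CompleteSpace E] (g : Metric F B)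
    (hf : ContMDiff 𝓘(ℝ, E) 𝓘(ℝ, F) ∞ f)
    {X Y : VField E M} (hX : SmoothVF X) (hY : SmoothVF Y) (x : M) :
    covAlong g f (fun y => mfderiv 𝓘(ℝ, E) 𝓘(ℝ, F) f y (Y y)) x (X x)
      - covAlong g f (fun y => mfderiv 𝓘(ℝ, E) 𝓘(ℝ, F) f y (X y)) x (Y x) =
      mfderiv 𝓘(ℝ, E) 𝓘(ℝ, F) f x (mlieBracket 𝓘(ℝ, E) X Y x) := by
  have hk : ContMDiffAt 𝓘(ℝ, E) 𝓘(ℝ, F) ∞ (extChartAt 𝓘(ℝ, F) (f x) ∘ f) x :=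
    (contMDiffAt_extChartAt (I := 𝓘(ℝ, F)) (x := f x)).comp x hf.contMDiffAt
  have hb := vecDeriv_mlieBracket hk hX hY
  have hc := (coord_mfderiv_eventuallyEq hf (mlieBracket 𝓘(ℝ, E) X Y) x).self_of_nhds
  simp only [coord_self] at hc
  refine Eq.trans ?_ (hb.symm.trans hc.symm)
  have h1 : coordDeriv f (fun y => mfderiv 𝓘(ℝ, E) 𝓘(ℝ, F) f y (Y y)) x (X x) =
      vecDeriv X (vecDeriv Y (extChartAt 𝓘(ℝ, F) (f x) ∘ f)) x :=
    congrArg (fun L : E →L[ℝ] F => L (X x)) (vderiv_congr (coord_mfderiv_eventuallyEq hf Y x))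
  have h2 : coordDeriv f (fun y => mfderiv 𝓘(ℝ, E) 𝓘(ℝ, F) f y (X y)) x (Y x) =
      vecDeriv Y (vecDeriv X (extChartAt 𝓘(ℝ, F) (f x) ∘ f)) x :=
    congrArg (fun L : E →L[ℝ] F => L (Y x)) (vderiv_congr (coord_mfderiv_eventuallyEq hf X x))
  -- The Christoffel terms cancel by symmetry; the commutator XYk − YXk remains.
  rw [covAlong_eq, covAlong_eq, christoffel_symm, add_sub_add_right_eq_sub]
  exact congrArg₂ (fun a b : F => a - b) h1 h2

end Connection

/-! ### The Levi-Civita connection, as the pullback along the identity. -/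

section LeviCivita

variable {E : Type*} [NormedAddCommGroup E] [NormedSpace ℝ E]
  {M : Type*} [TopologicalSpace M] [ChartedSpace E M] [IsManifold 𝓘(ℝ, E) ∞ M]
  (g : Metric E M) {X Y Z : VField E M}

theorem SmoothVF.mdiffAlongAt (hX : SmoothVF X) (x : M) : MDiffAlongAt E (fun y : M => y) X x :=
  hX.mdifferentiable (by simp) x

theorem cov_eq (X Y : VField E M) (x : M) :
    cov g X Y x = coordDeriv (fun y : M => y) Y x (X x) + christoffel g x (X x) (Y x) := by
  have h : mfderiv 𝓘(ℝ, E) 𝓘(ℝ, E) (fun y : M => y) x = ContinuousLinearMap.id ℝ _ := mfderiv_id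
  have h' : mfderiv 𝓘(ℝ, E) 𝓘(ℝ, E) (fun y : M => y) x (X x) = X x :=
    congrArg (fun L : E →L[ℝ] E => L (X x)) h
  have h0 : cov g X Y x = covAlong g (fun y : M => y) Y x (X x) := rfl
  rw [h0, covAlong_eq, h']

theorem dirDeriv_inner [FiniteDimensional ℝ E] (X : VField E M) (hY : SmoothVF Y)
    (hZ : SmoothVF Z) (x : M) :
    dirDeriv X (fun y => g.inner y (Y y) (Z y)) x =
      g.inner x (cov g X Y x) (Z x) + g.inner x (Y x) (cov g X Z x) :=
  vderiv_inner g (hY.mdiffAlongAt x) (hZ.mdiffAlongAt x) (X x)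

theorem cov_sub_cov [FiniteDimensional ℝ E] (hX : SmoothVF X) (hY : SmoothVF Y) (x : M) :
    cov g X Y x - cov g Y X x = mlieBracket 𝓘(ℝ, E) X Y x := by
  have : CompleteSpace E := FiniteDimensional.complete ℝ E
  have h := covAlong_mfderiv_sub g (contMDiff_id (I := 𝓘(ℝ, E)) (M := M) (n := ∞)) hX hY x
  have hid : ∀ y : M, mfderiv 𝓘(ℝ, E) 𝓘(ℝ, E) (id : M → M) y = ContinuousLinearMap.id ℝ _ :=
    fun y => mfderiv_id
  simp only [hid] at h
  exact h

theorem cov_add [FiniteDimensional ℝ E] (X : VField E M) (hY : SmoothVF Y) (hZ : SmoothVF Z)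
    (x : M) : cov g X (fun y => Y y + Z y) x = cov g X Y x + cov g X Z x := by
  have hev : (fun y => coord x (Y y + Z y)) =ᶠ[𝓝 x] fun y => coord x (Y y) + coord x (Z y) := by
    filter_upwards [(chartAt E x).open_source.mem_nhds (mem_chart_source E x)] with y hy
    simp only [coord_eq_continuousLinearMapAt hy, map_add]
  have hd : coordDeriv (fun y : M => y) (fun y => Y y + Z y) x (X x) =
      coordDeriv (fun y : M => y) Y x (X x) + coordDeriv (fun y : M => y) Z x (X x) :=
    congrArg (fun L : E →L[ℝ] E => L (X x)) ((vderiv_congr hev).trans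
      (vderiv_add (hY.mdiffAlongAt x).coord (hZ.mdiffAlongAt x).coord))
  rw [cov_eq, cov_eq, cov_eq, hd, christoffel_add]
  exact add_add_add_comm _ _ _ _

theorem cov_neg [FiniteDimensional ℝ E] (X Y : VField E M) (x : M) :
    cov g X (fun y => - Y y) x = - cov g X Y x := by
  have hev : (fun y => coord x (- Y y)) =ᶠ[𝓝 x] fun y => - coord x (Y y) := by
    filter_upwards [(chartAt E x).open_source.mem_nhds (mem_chart_source E x)] with y hy
    simp only [coord_eq_continuousLinearMapAt hy, map_neg]
  have hd : coordDeriv (fun y : M => y) (fun y => - Y y) x (X x) =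
      - coordDeriv (fun y : M => y) Y x (X x) :=
    congrArg (fun L : E →L[ℝ] E => L (X x)) ((vderiv_congr hev).trans
      (vderiv_neg (fun y => coord x (Y y)) x))
  rw [cov_eq, cov_eq, hd, christoffel_neg]
  exact (neg_add _ _).symm

end LeviCivita

/-! ### Vertical and horizontal projections. -/

section Projections

variable {E : Type*} [NormedAddCommGroup E] [NormedSpace ℝ E] [FiniteDimensional ℝ E]
  {M : Type*} [TopologicalSpace M] [ChartedSpace E M] [IsManifold 𝓘(ℝ, E) ∞ M]
  {F : Type*} [NormedAddCommGroup F] [NormedSpace ℝ F]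
  {B : Type*} [TopologicalSpace B] [ChartedSpace F B]
  {g : Metric E M} {pr : M → B} {x : M}

theorem hProj_add_vProj (u : TangentSpace 𝓘(ℝ, E) x) :
    hProj (F := F) g pr x u + vProj (F := F) g pr x u = u :=
  Submodule.projection_add_projection_eq_self _ u

theorem hProj_mem (u : TangentSpace 𝓘(ℝ, E) x) :
    hProj (F := F) g pr x u ∈ horiz (F := F) g pr x :=
  Submodule.projection_apply_mem _ u

theorem vProj_mem (u : TangentSpace 𝓘(ℝ, E) x) :
    vProj (F := F) g pr x u ∈ vert (F := F) pr x :=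
  Submodule.projection_apply_mem _ u

theorem hProj_of_horiz {u : TangentSpace 𝓘(ℝ, E) x} (hu : u ∈ horiz (F := F) g pr x) :
    hProj (F := F) g pr x u = u :=
  Submodule.projection_apply_of_mem_left _ hu

theorem vProj_of_vert {u : TangentSpace 𝓘(ℝ, E) x} (hu : u ∈ vert (F := F) pr x) :
    vProj (F := F) g pr x u = u :=
  Submodule.projection_apply_of_mem_left _ hu

theorem hProj_of_vert {u : TangentSpace 𝓘(ℝ, E) x} (hu : u ∈ vert (F := F) pr x) :
    hProj (F := F) g pr x u = 0 :=
  (Submodule.projection_apply_eq_zero_iff _).2 hu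

omit [FiniteDimensional ℝ E] in
theorem inner_vert_horiz {u v : TangentSpace 𝓘(ℝ, E) x} (hu : u ∈ vert (F := F) pr x)
    (hv : v ∈ horiz (F := F) g pr x) : g.inner x u v = 0 :=
  (g.symm x u v).trans (hv u hu)

/-- The inner product with a horizontal vector only sees the horizontal part. -/
theorem inner_hProj_left {v : TangentSpace 𝓘(ℝ, E) x} (hv : v ∈ horiz (F := F) g pr x)
    (u : TangentSpace 𝓘(ℝ, E) x) :
    g.inner x (hProj (F := F) g pr x u) v = g.inner x u v := by
  conv_rhs => rw [← hProj_add_vProj (F := F) (g := g) (pr := pr) u, inner_add_left,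
    inner_vert_horiz (vProj_mem u) hv, add_zero]

theorem inner_vProj_left {v : TangentSpace 𝓘(ℝ, E) x} (hv : v ∈ vert (F := F) pr x)
    (u : TangentSpace 𝓘(ℝ, E) x) :
    g.inner x (vProj (F := F) g pr x u) v = g.inner x u v := by
  conv_rhs => rw [← hProj_add_vProj (F := F) (g := g) (pr := pr) u, inner_add_left,
    hProj_mem u v hv, zero_add]

theorem mfderiv_hProj (u : TangentSpace 𝓘(ℝ, E) x) :
    mfderiv 𝓘(ℝ, E) 𝓘(ℝ, F) pr x (hProj (F := F) g pr x u) = mfderiv 𝓘(ℝ, E) 𝓘(ℝ, F) pr x u := by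
  have h : mfderiv 𝓘(ℝ, E) 𝓘(ℝ, F) pr x (vProj (F := F) g pr x u) = 0 :=
    vProj_mem (F := F) (g := g) (pr := pr) u
  conv_rhs => rw [← hProj_add_vProj (F := F) (g := g) (pr := pr) u, map_add, h, add_zero]

variable [IsManifold 𝓘(ℝ, F) ∞ B] {gB : Metric F B}

omit [FiniteDimensional ℝ E] in
theorem IsRiemannianSubmersion.inner_mfderiv_of_horiz (h : IsRiemannianSubmersion g gB pr)
    -- Polarization of the length-preserving condition.
    {u v : TangentSpace 𝓘(ℝ, E) x} (hu : u ∈ horiz (F := F) g pr x)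
    (hv : v ∈ horiz (F := F) g pr x) :
    gB.inner (pr x) (mfderiv 𝓘(ℝ, E) 𝓘(ℝ, F) pr x u) (mfderiv 𝓘(ℝ, E) 𝓘(ℝ, F) pr x v) =
      g.inner x u v := by
  have h1 := h.isometry x _ ((horiz (F := F) g pr x).add_mem hu hv)
  rw [map_add, inner_add_left, inner_add_left, inner_add_right, inner_add_right, inner_add_right,
    inner_add_right,
    h.isometry x u hu, h.isometry x v hv, g.symm x v u, gB.symm (pr x) (mfderiv _ _ pr x v)] at h1
  linarith

theorem IsRiemannianSubmersion.inner_mfderiv (h : IsRiemannianSubmersion g gB pr)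
    (u v : TangentSpace 𝓘(ℝ, E) x) :
    gB.inner (pr x) (mfderiv 𝓘(ℝ, E) 𝓘(ℝ, F) pr x u) (mfderiv 𝓘(ℝ, E) 𝓘(ℝ, F) pr x v) =
      g.inner x (hProj (F := F) g pr x u) v := by
  rw [← mfderiv_hProj (g := g) u, ← mfderiv_hProj (g := g) v,
    h.inner_mfderiv_of_horiz (hProj_mem u) (hProj_mem v), g.symm, inner_hProj_left (hProj_mem u),
    g.symm]

end Projections

/-! ### Smoothness of projected fields, and global extension of tangent vectors. -/

section Smoothness

variable {E : Type*} [NormedAddCommGroup E] [NormedSpace ℝ E]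
  {M : Type*} [TopologicalSpace M] [ChartedSpace E M] [IsManifold 𝓘(ℝ, E) ∞ M]

theorem smoothVF_iff {X : VField E M} :
    SmoothVF X ↔ ∀ p : M, ContMDiffAt 𝓘(ℝ, E) 𝓘(ℝ, E) ∞ (fun y => coord p (X y)) p :=
  forall_congr' fun p => contMDiffAt_section p

theorem SmoothVF.sub {X Y : VField E M} (hX : SmoothVF X) (hY : SmoothVF Y) :
    SmoothVF (fun y => X y - Y y) :=
  ContMDiff.sub_section hX hY

theorem SmoothVF.jField {J : EndField E M} (hJ : SmoothEnd J) {X : VField E M} (hX : SmoothVF X) :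
    SmoothVF (jField J X) :=
  ContMDiff.clm_bundle_apply hJ hX

/-- A local smooth extension is cut off by a bump function; the Hausdorff condition makes the cutoff
smooth on all of M. -/
theorem exists_smoothVF_apply_eq [FiniteDimensional ℝ E] [T2Space M] (p : M)
    (v : TangentSpace 𝓘(ℝ, E) p) : ∃ X : VField E M, SmoothVF X ∧ X p = v := by
  obtain ⟨s, hs, hsm⟩ := FiberBundle.exists_contMDiffOn_extend (k := ∞) 𝓘(ℝ, E) E v
  obtain ⟨f, -, hf⟩ := (SmoothBumpFunction.nhds_basis_tsupport (I := 𝓘(ℝ, E)) p).mem_iff.1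
    (interior_mem_nhds.2 hs)
  refine ⟨fun y => f y • FiberBundle.extend E v y, ?_, ?_⟩
  · exact ContMDiffOn.smul_section_of_tsupport f.contMDiff.contMDiffOn isOpen_interior hf
      (hsm.mono interior_subset)
  · simp only [f.eq_one, one_smul, FiberBundle.extend_apply_self]

theorem isInvertible_chartMetric [FiniteDimensional ℝ E] (g : Metric E M) {p y : M}
    (hy : y ∈ (chartAt E p).source) : (chartMetric g p y).IsInvertible := by
  refine isInvertible_of_definite _ fun v hv => ?_
  by_contra hne
  rw [chartMetric_apply] at hv
  refine (g.pos y _ fun h => hne ?_).ne' hv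
  have := (trivializationAt E (TangentSpace 𝓘(ℝ, E)) p).continuousLinearMapAt_symmL (R := ℝ)
    (b := y) hy v
  rw [← this, h, map_zero]

variable {F : Type*} [NormedAddCommGroup F] [NormedSpace ℝ F]
  {B : Type*} [TopologicalSpace B] [ChartedSpace F B] [IsManifold 𝓘(ℝ, F) ∞ B]
  {g : Metric E M} {gB : Metric F B} {pr : M → B}

/-- For every v, g(ℋW, v) = g_B(π_*W, π_*v). In charts ℋW is therefore G⁻¹ Pᵀ G_B P W, with P the
matrix of π_* and G, G_B the two metrics; every factor is smooth, and no frame of ker π_* is needed.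
-/
theorem SmoothVF.hProj [FiniteDimensional ℝ E] (h : IsRiemannianSubmersion g gB pr)
    {W : VField E M} (hW : SmoothVF W) : SmoothVF (fun y => hProj (F := F) g pr y (W y)) := by
  rw [smoothVF_iff]
  intro p
  let P : M → E →L[ℝ] F :=
    inTangentCoordinates 𝓘(ℝ, E) 𝓘(ℝ, F) id pr (mfderiv 𝓘(ℝ, E) 𝓘(ℝ, F) pr) p
  have hP : ContMDiffAt 𝓘(ℝ, E) 𝓘(ℝ, E →L[ℝ] F) ∞ P p :=
    h.smooth.contMDiffAt.mfderiv_const (by simp)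
  have hG : ContMDiffAt 𝓘(ℝ, E) 𝓘(ℝ, F →L[ℝ] F →L[ℝ] ℝ) ∞
      (fun y => chartMetric gB (pr p) (pr y)) p :=
    (contMDiffAt_chartMetric gB (pr p)).comp p h.smooth.contMDiffAt
  have hw : ContMDiffAt 𝓘(ℝ, E) 𝓘(ℝ, F) ∞
      (fun y => coord (pr p) (mfderiv 𝓘(ℝ, E) 𝓘(ℝ, F) pr y (W y))) p :=
    (contMDiffAt_totalSpace.1
      (((h.smooth.contMDiff_tangentMap (m := ∞) (by simp)).comp hW).contMDiffAt (x := p))).2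
  have hinv : ContMDiffAt 𝓘(ℝ, E) 𝓘(ℝ, (E →L[ℝ] ℝ) →L[ℝ] E) ∞
      (fun y => (chartMetric g p y).inverse) p :=
    ContMDiffAt.comp p (isInvertible_chartMetric g
      (mem_chart_source E p)).contDiffAt_map_inverse.contMDiffAt (contMDiffAt_chartMetric g p)
  refine (hinv.clm_apply ((hG.clm_apply hw).clm_comp hP)).congr_of_eventuallyEq ?_
  filter_upwards [(chartAt E p).open_source.mem_nhds (mem_chart_source E p),
    eventually_mem_chart_source (F := F) (h.smooth.continuous.continuousAt (x := p))] with y hy hy'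
  rw [eq_comm, (isInvertible_chartMetric g hy).inverse_apply_eq]
  ext v
  have hPv : P y v = coord (pr p) (mfderiv 𝓘(ℝ, E) 𝓘(ℝ, F) pr y
      ((trivializationAt E (TangentSpace 𝓘(ℝ, E)) p).symmL ℝ y v)) :=
    (coord_eq_continuousLinearMapAt hy' _).symm
  rw [ContinuousLinearMap.comp_apply, hPv, chartMetric_coord gB hy', h.inner_mfderiv,
    chartMetric_apply, symmL_coord hy]

theorem SmoothVF.vProj [FiniteDimensional ℝ E] (h : IsRiemannianSubmersion g gB pr)
    {W : VField E M} (hW : SmoothVF W) : SmoothVF (fun y => vProj (F := F) g pr y (W y)) := by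
  have : (fun y => LCK.vProj (F := F) g pr y (W y)) =
      fun y => W y - LCK.hProj (F := F) g pr y (W y) := by
    funext y
    exact eq_sub_of_add_eq' (hProj_add_vProj (W y))
  rw [this]
  exact hW.sub (hW.hProj h)

end Smoothness

/-! ### The covariant derivative of J on an l.c.K. manifold. -/

section NablaJ

variable {E : Type*} [NormedAddCommGroup E] [NormedSpace ℝ E] [FiniteDimensional ℝ E]
  {M : Type*} [TopologicalSpace M] [ChartedSpace E M] [IsManifold 𝓘(ℝ, E) ∞ M]
  {g : Metric E M} {J : EndField E M} {lee : OneForm E M} {X Y Z : VField E M}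

omit [FiniteDimensional ℝ E] [IsManifold 𝓘(ℝ, E) ∞ M] in
theorem dirDeriv_neg (X : VField E M) (f : M → ℝ) (x : M) :
    dirDeriv X (fun y => -f y) x = -dirDeriv X f x :=
  congrArg (fun L : E →L[ℝ] ℝ => L (X x)) (vderiv_neg (E := E) f x)

omit [FiniteDimensional ℝ E] in
theorem IsHermitian.inner_J_left (h : IsHermitian g J) {x : M} (u v : TangentSpace 𝓘(ℝ, E) x) :
    g.inner x (J x u) v = -g.inner x u (J x v) := by
  rw [← h.compat x u (J x v), h.sq, inner_neg_right, neg_neg]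

omit [FiniteDimensional ℝ E] in
theorem IsHermitian.jField_jField (h : IsHermitian g J) (X : VField E M) :
    jField J (jField J X) = fun y => -X y :=
  funext fun y => h.sq y (X y)

/-- The tensor `g((∇_X J) Y, Z)`. -/
def nablaJ (g : Metric E M) (J : EndField E M) (X Y Z : VField E M) (x : M) : ℝ :=
  g.inner x (cov g X (jField J Y) x) (Z x) + g.inner x (cov g X Y x) (J x (Z x))

/-- Since J is g-skew, so is ∇_X J: differentiate g(JY, Z) = −g(Y, JZ) along X. -/
theorem IsHermitian.nablaJ_skew (h : IsHermitian g J) (X : VField E M) (hY : SmoothVF Y)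
    (hZ : SmoothVF Z) (x : M) : nablaJ g J X Y Z x = -nablaJ g J X Z Y x := by
  have h1 := dirDeriv_inner g X (hY.jField h.smooth) hZ x
  have h2 := dirDeriv_inner g X hY (hZ.jField h.smooth) x
  have h3 : (fun y => g.inner y (jField J Y y) (Z y)) =
      fun y => -g.inner y (Y y) (jField J Z y) := funext fun y => h.inner_J_left _ _
  rw [h3, dirDeriv_neg, h2] at h1
  have e1 := g.symm x (Y x) (cov g X (jField J Z) x)
  have e2 := g.symm x (J x (Y x)) (cov g X Z x)
  simp only [nablaJ, jField] at *
  linarith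

/-- Differentiating J² = −1 shows that ∇_X J anticommutes with J, and J is g-skew. -/
theorem IsHermitian.nablaJ_jField (h : IsHermitian g J) (X Y Z : VField E M) (x : M) :
    nablaJ g J X (jField J Y) Z x = nablaJ g J X Y (jField J Z) x := by
  simp only [nablaJ]
  rw [h.jField_jField, cov_neg, inner_neg_left]
  simp only [jField]
  rw [h.sq, inner_neg_right]
  ring

/-- Torsion-freeness turns the brackets into covariant derivatives, and all terms without a
derivative of J cancel. -/
theorem IsHermitian.extDeriv₂_kahlerForm (h : IsHermitian g J) (hX : SmoothVF X)
    (hY : SmoothVF Y) (hZ : SmoothVF Z) (x : M) :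
    extDeriv₂ (kahlerForm g J) X Y Z x =
      nablaJ g J X Z Y x - nablaJ g J Y Z X x + nablaJ g J Z Y X x := by
  have d1 := dirDeriv_inner g X hY (hZ.jField h.smooth) x
  have d2 := dirDeriv_inner g Y hX (hZ.jField h.smooth) x
  have d3 := dirDeriv_inner g Z hX (hY.jField h.smooth) x
  simp only [extDeriv₂, kahlerForm, nablaJ]
  simp only [jField] at *
  rw [d1, d2, d3, ← cov_sub_cov g hX hY, ← cov_sub_cov g hX hZ, ← cov_sub_cov g hY hZ,
    inner_sub_left, inner_sub_left, inner_sub_left, g.symm x (Y x), g.symm x (X x), g.symm x (X x)]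
  ring

/-- This is g(N(Y,Z), JX) = 0 for the Nijenhuis tensor N, with each bracket written through ∇. -/
theorem IsHermitian.nablaJ_of_integrable (h : IsHermitian g J) (X : VField E M)
    (hY : SmoothVF Y) (hZ : SmoothVF Z) (x : M) :
    nablaJ g J (jField J Y) Z (jField J X) x - nablaJ g J (jField J Z) Y (jField J X) x
      - nablaJ g J Y Z X x + nablaJ g J Z Y X x = 0 := by
  have hN : nijenhuis J Y Z x = 0 := h.integrable Y Z hY hZ x
  have hJY := hY.jField h.smooth
  have hJZ := hZ.jField h.smooth
  have hN' : mlieBracket 𝓘(ℝ, E) (jField J Y) (jField J Z) x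
      - J x (mlieBracket 𝓘(ℝ, E) (jField J Y) Z x) - J x (mlieBracket 𝓘(ℝ, E) Y (jField J Z) x)
      - mlieBracket 𝓘(ℝ, E) Y Z x = 0 := hN
  rw [← cov_sub_cov g hJY hJZ, ← cov_sub_cov g hJY hZ, ← cov_sub_cov g hY hJZ,
    ← cov_sub_cov g hY hZ] at hN'
  have h0 := congrArg (fun u => g.inner x u (J x (X x))) hN'
  simp only [inner_sub_left, h.compat, map_zero, zero_apply] at h0
  simp only [nablaJ]
  simp only [jField] at *
  rw [h.sq, inner_neg_right, inner_neg_right]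
  linarith

/-- The covariant derivative of the complex structure of a locally conformal Kähler manifold. -/
theorem IsLCK.nablaJ_eq (h : IsLCK g J lee) (hX : SmoothVF X) (hY : SmoothVF Y)
    (hZ : SmoothVF Z) (x : M) :
    2 * nablaJ g J X Y Z x =
      lee x (J x (Y x)) * g.inner x (X x) (Z x) - lee x (J x (Z x)) * g.inner x (X x) (Y x)
      + lee x (Y x) * g.inner x (X x) (J x (Z x)) - lee x (Z x) * g.inner x (X x) (J x (Y x)) := by
  have hH := h.hermitian
  have hJX := hX.jField hH.smooth
  have hJY := hY.jField hH.smooth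
  have hJZ := hZ.jField hH.smooth
  -- The difference dΩ(X,JY,JZ) − dΩ(X,Y,Z) contains g((∇_X J)Y, Z) twice. Its other terms, with J
  -- differentiated along Y, Z, JY and JZ, cancel against the integrability relation `n`.
  have d1 := h.dKahler X Y Z hX hY hZ x
  have d2 := h.dKahler X (jField J Y) (jField J Z) hX hJY hJZ x
  rw [hH.extDeriv₂_kahlerForm hX hY hZ, hH.nablaJ_skew X hZ hY, hH.nablaJ_skew Y hZ hX,
    hH.nablaJ_skew Z hY hX] at d1
  rw [hH.extDeriv₂_kahlerForm hX hJY hJZ, hH.nablaJ_jField X Z, hH.nablaJ_skew X hZ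
    (hJY.jField hH.smooth), hH.jField_jField, hH.nablaJ_skew _ hJZ hX, hH.nablaJ_skew _ hJY hX] at d2
  have hneg : nablaJ g J X (fun y => -Y y) Z x = -nablaJ g J X Y Z x := by
    have : nablaJ g J X (jField J (jField J Y)) Z x = -nablaJ g J X Y Z x := by
      rw [hH.nablaJ_jField, hH.nablaJ_jField, hH.jField_jField]
      simp only [nablaJ]
      rw [inner_neg_right, map_neg (J x) (Z x), inner_neg_right]
      ring
    rwa [hH.jField_jField] at this
  have n := hH.nablaJ_of_integrable X hY hZ x
  rw [hH.nablaJ_skew _ hZ hJX, hH.nablaJ_jField _ X Z, hH.nablaJ_skew _ hY hJX,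
    hH.nablaJ_jField _ X Y, hH.nablaJ_skew Y hZ hX, hH.nablaJ_skew Z hY hX] at n
  rw [hneg] at d2
  simp only [kahlerForm] at d1 d2
  simp only [jField] at *
  rw [hH.compat, hH.sq, hH.sq, inner_neg_right, inner_neg_right] at d2
  linarith

end NablaJ

/-! ### The second fundamental form and O'Neill's tensor of a Riemannian submersion. -/

section Submersion

variable {E : Type*} [NormedAddCommGroup E] [NormedSpace ℝ E] [FiniteDimensional ℝ E]
  {M : Type*} [TopologicalSpace M] [ChartedSpace E M] [IsManifold 𝓘(ℝ, E) ∞ M]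
  {F : Type*} [NormedAddCommGroup F] [NormedSpace ℝ F] [FiniteDimensional ℝ F]
  {B : Type*} [TopologicalSpace B] [ChartedSpace F B] [IsManifold 𝓘(ℝ, F) ∞ B]
  {g : Metric E M} {gB : Metric F B} {pr : M → B} {X Y Z : VField E M}

/-- Both connections are torsion-free, so both antisymmetrizations give π_*[X,Y]. -/
theorem secondFF_symm (hpr : ContMDiff 𝓘(ℝ, E) 𝓘(ℝ, F) ∞ pr) (hX : SmoothVF X) (hY : SmoothVF Y)
    (x : M) : secondFF g gB pr X Y x = secondFF g gB pr Y X x := by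
  have : CompleteSpace E := FiniteDimensional.complete ℝ E
  have h1 := covAlong_mfderiv_sub gB hpr hX hY x
  rw [← cov_sub_cov g hX hY, map_sub] at h1
  simp only [secondFF]
  rw [sub_eq_sub_iff_sub_eq_sub, h1]

/-- The functions g(Y,Z) and g_B(π_*Y, π_*Z) agree; differentiate both along X with their metric
connections and compare. -/
theorem IsRiemannianSubmersion.secondFF_skew (h : IsRiemannianSubmersion g gB pr)
    (X : VField E M) (hY : IsHorizontal (F := F) g pr Y) (hZ : IsHorizontal (F := F) g pr Z)
    (x : M) :
    gB.inner (pr x) (secondFF g gB pr X Y x) (mfderiv 𝓘(ℝ, E) 𝓘(ℝ, F) pr x (Z x)) =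
      -gB.inner (pr x) (secondFF g gB pr X Z x) (mfderiv 𝓘(ℝ, E) 𝓘(ℝ, F) pr x (Y x)) := by
  have h1 := vderiv_inner gB (mdiffAlongAt_mfderiv h.smooth hY.1 x)
    (mdiffAlongAt_mfderiv h.smooth hZ.1 x) (X x)
  have h2 := vderiv_inner g (hY.1.mdiffAlongAt x) (hZ.1.mdiffAlongAt x) (X x)
  have h3 : (fun y => gB.inner (pr y) (mfderiv 𝓘(ℝ, E) 𝓘(ℝ, F) pr y (Y y))
      (mfderiv 𝓘(ℝ, E) 𝓘(ℝ, F) pr y (Z y))) = fun y => g.inner y (Y y) (Z y) :=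
    funext fun y => h.inner_mfderiv_of_horiz (hY.2 y) (hZ.2 y)
  have h4 : gB.inner (pr x) (mfderiv 𝓘(ℝ, E) 𝓘(ℝ, F) pr x (cov g X Y x))
      (mfderiv 𝓘(ℝ, E) 𝓘(ℝ, F) pr x (Z x)) = g.inner x (cov g X Y x) (Z x) := by
    rw [h.inner_mfderiv, inner_hProj_left (hZ.2 x)]
  have h5 : gB.inner (pr x) (mfderiv 𝓘(ℝ, E) 𝓘(ℝ, F) pr x (cov g X Z x))
      (mfderiv 𝓘(ℝ, E) 𝓘(ℝ, F) pr x (Y x)) = g.inner x (Y x) (cov g X Z x) := by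
    rw [h.inner_mfderiv, inner_hProj_left (hY.2 x), g.symm]
  rw [h3] at h1
  have h6 := h1.symm.trans h2
  simp only [secondFF]
  rw [inner_sub_left, inner_sub_left, h4, h5]
  rw [gB.symm (pr x) (mfderiv 𝓘(ℝ, E) 𝓘(ℝ, F) pr x (Y x))] at h6
  simp only [cov]
  linarith

/-- The second fundamental form of a Riemannian submersion vanishes on horizontal fields. -/
theorem IsRiemannianSubmersion.inner_secondFF_horizontal (h : IsRiemannianSubmersion g gB pr)
    (hX : IsHorizontal (F := F) g pr X) (hY : IsHorizontal (F := F) g pr Y)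
    (hZ : IsHorizontal (F := F) g pr Z) (x : M) :
    gB.inner (pr x) (secondFF g gB pr X Y x) (mfderiv 𝓘(ℝ, E) 𝓘(ℝ, F) pr x (Z x)) = 0 := by
  -- A trilinear expression that is symmetric in its first two arguments and skew in its last two is
  -- zero: three alternations of these swaps return it to its own negative.
  have h1 := h.secondFF_skew X hY hZ x
  have h2 := h.secondFF_skew Z hX hY x
  have h3 := h.secondFF_skew Y hZ hX x
  rw [secondFF_symm h.smooth hX.1 hZ.1] at h1
  rw [secondFF_symm h.smooth hZ.1 hY.1] at h2
  rw [secondFF_symm h.smooth hY.1 hX.1] at h3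
  linarith

theorem cov_zero (g : Metric E M) (X : VField E M) (x : M) :
    cov g X (fun _ => 0) x = 0 := by
  have h := cov_neg g X (fun _ => 0) x
  simp only [neg_zero] at h
  refine inner_ext g fun w => ?_
  have := congrArg (fun u => g.inner x u w) h
  simp only [inner_neg_left] at this
  rw [map_zero, zero_apply]
  linarith

omit [FiniteDimensional ℝ F] [IsManifold 𝓘(ℝ, F) ∞ B] in
/-- O'Neill's tensor on a horizontal and a vertical field. -/
theorem oneillA_of_horizontal_vertical {V : VField E M}
    (hX : ∀ y, X y ∈ horiz (F := F) g pr y) (hV : ∀ y, V y ∈ vert (F := F) pr y) (x : M) :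
    oneillA (F := F) g pr X V x = hProj (F := F) g pr x (cov g X V x) := by
  have h1 : (fun y => hProj (F := F) g pr y (X y)) = X := funext fun y => hProj_of_horiz (hX y)
  have h2 : (fun y => vProj (F := F) g pr y (V y)) = V := funext fun y => vProj_of_vert (hV y)
  have h3 : (fun y => hProj (F := F) g pr y (V y)) = fun _ => 0 :=
    funext fun y => hProj_of_vert (hV y)
  rw [oneillA, h1, h2, h3, cov_zero, map_zero, add_zero]

end Submersion

/-! ### Anti-invariant submersions: the identities behind the equivalences. -/

section AntiInvariant

variable {E : Type*} [NormedAddCommGroup E] [NormedSpace ℝ E] [FiniteDimensional ℝ E]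
  {M : Type*} [TopologicalSpace M] [ChartedSpace E M] [IsManifold 𝓘(ℝ, E) ∞ M]
  {F : Type*} [NormedAddCommGroup F] [NormedSpace ℝ F] [FiniteDimensional ℝ F]
  {B : Type*} [TopologicalSpace B] [ChartedSpace F B] [IsManifold 𝓘(ℝ, F) ∞ B]
  {g : Metric E M} {J : EndField E M} {lee : OneForm E M} {gB : Metric F B} {pr : M → B}
  {X Y V : VField E M}

omit [FiniteDimensional ℝ F] [IsManifold 𝓘(ℝ, F) ∞ B] in
theorem jField_eq (g : Metric E M) (J : EndField E M) (pr : M → B) (Y : VField E M) :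
    jField J Y = fun y => cPart (F := F) g J pr Y y + bPart (F := F) g J pr Y y :=
  funext fun y => (hProj_add_vProj (J y (Y y))).symm

omit [FiniteDimensional ℝ F] in
-- As Jv is horizontal, g(CY, Jv) = g(JY, Jv) = g(Y, v) = 0.
theorem IsAntiInvariantSubmersion.inner_cPart_J (h : IsAntiInvariantSubmersion g J gB pr)
    (hJ : IsHermitian g J) (hY : IsHorizontal (F := F) g pr Y) {x : M}
    {v : TangentSpace 𝓘(ℝ, E) x} (hv : v ∈ vert (F := F) pr x) :
    g.inner x (cPart (F := F) g J pr Y x) (J x v) = 0 := by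
  rw [cPart, inner_hProj_left (h.antiInvariant x v hv), hJ.compat]
  exact hY.2 x v hv

omit [FiniteDimensional ℝ F] in
theorem isHorizontal_cPart (h : IsRiemannianSubmersion g gB pr) (hJ : SmoothEnd J)
    (hY : SmoothVF Y) : IsHorizontal (F := F) g pr (cPart (F := F) g J pr Y) :=
  ⟨(hY.jField hJ).hProj h, fun _ => hProj_mem _⟩

omit [FiniteDimensional ℝ F] in
theorem isVertical_bPart (h : IsRiemannianSubmersion g gB pr) (hJ : SmoothEnd J)
    (hY : SmoothVF Y) : IsVertical (F := F) pr (bPart (F := F) g J pr Y) :=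
  ⟨(hY.jField hJ).vProj h, fun _ => vProj_mem _⟩

omit [FiniteDimensional ℝ E] [FiniteDimensional ℝ F] in
theorem IsAntiInvariantSubmersion.isHorizontal_jField (h : IsAntiInvariantSubmersion g J gB pr)
    (hJ : SmoothEnd J) (hV : IsVertical (F := F) pr V) :
    IsHorizontal (F := F) g pr (jField J V) :=
  ⟨hV.1.jField hJ, fun x => h.antiInvariant x _ (hV.2 x)⟩

omit [FiniteDimensional ℝ F] in
/-- The vertical part of `∇_X Y` for horizontal `X`, `Y`, when the Lee field is vertical. -/
theorem IsAntiInvariantSubmersion.inner_cov_horizontal (h : IsAntiInvariantSubmersion g J gB pr)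
    (hM : IsLCK g J lee) (hLee : ∀ x : M, leeVector g lee x ∈ vert (F := F) pr x)
    (hX : IsHorizontal (F := F) g pr X) (hY : IsHorizontal (F := F) g pr Y)
    (hV : IsVertical (F := F) pr V) (x : M) :
    g.inner x (cov g X Y x) (V x) =
      g.inner x (oneillA (F := F) g pr X (bPart (F := F) g J pr Y) x) (J x (V x))
      - (g.inner x (cPart (F := F) g J pr Y x) (J x (oneillA (F := F) g pr X V x))
        - 1 / 2 * lee x (V x) *
          g.inner x (cPart (F := F) g J pr Y x) (cPart (F := F) g J pr X x)
        + 1 / 2 * g.inner x (bPart (F := F) g J pr Y x) (leeVector g lee x)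
          * g.inner x (X x) (J x (V x))
        + 1 / 2 * g.inner x (X x) (Y x) * g.inner x (leeVector g lee x) (V x)) := by
  have hH := hM.hermitian
  have hJs := hH.smooth
  have hC := isHorizontal_cPart h.toIsRiemannianSubmersion hJs hY.1
  have hB := isVertical_bPart h.toIsRiemannianSubmersion hJs hY.1
  have hJV := h.isHorizontal_jField hJs hV
  have hlee : ∀ u, lee x u = g.inner x (leeVector g lee x) u :=
    fun u => (inner_sharp g x (lee x) u).symm
  have hlee0 : ∀ u ∈ horiz (F := F) g pr x, lee x u = 0 :=
    fun u hu => (hlee u).trans (inner_vert_horiz (hLee x) hu)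
  have hJVx : J x (V x) ∈ horiz (F := F) g pr x := hJV.2 x
  have hXV : g.inner x (X x) (V x) = 0 := hX.2 x _ (hV.2 x)
  -- the two values of the O'Neill tensor
  have a1 : g.inner x (oneillA (F := F) g pr X (bPart (F := F) g J pr Y) x) (J x (V x)) =
      g.inner x (cov g X (bPart (F := F) g J pr Y) x) (J x (V x)) := by
    rw [oneillA_of_horizontal_vertical hX.2 hB.2, inner_hProj_left hJVx]
  have a2 : g.inner x (cPart (F := F) g J pr Y x) (J x (oneillA (F := F) g pr X V x)) =
      g.inner x (cPart (F := F) g J pr Y x) (J x (cov g X V x)) := by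
    rw [oneillA_of_horizontal_vertical hX.2 hV.2]
    -- Adding the vertical part of ∇_X V changes nothing, because CY ⊥ J(ker π_*).
    conv_rhs => rw [← hProj_add_vProj (F := F) (g := g) (pr := pr) (cov g X V x), map_add,
      inner_add_right, h.inner_cPart_J hH hY (vProj_mem _), add_zero]
  -- `g(CY, JV)` vanishes identically
  have d : g.inner x (cov g X (cPart (F := F) g J pr Y) x) (J x (V x)) +
      g.inner x (cPart (F := F) g J pr Y x) (cov g X (jField J V) x) = 0 := by
    have hd := dirDeriv_inner g X hC.1 hJV.1 x
    have h0 : (fun y => g.inner y (cPart (F := F) g J pr Y y) (jField J V y)) = fun _ => 0 :=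
      funext fun y => h.inner_cPart_J hH hY (hV.2 y)
    have h00 : dirDeriv X (fun _ : M => (0 : ℝ)) x = 0 :=
      congrArg (fun L : E →L[ℝ] ℝ => L (X x)) mfderiv_const
    rw [h0, h00] at hd
    exact hd.symm
  have s : g.inner x (cov g X (jField J Y) x) (J x (V x)) =
      g.inner x (cov g X (cPart (F := F) g J pr Y) x) (J x (V x)) +
      g.inner x (cov g X (bPart (F := F) g J pr Y) x) (J x (V x)) := by
    rw [jField_eq (F := F) g J pr Y, cov_add g X hC.1 hB.1, inner_add_left]
  -- `t1` trades ∇_X Y against V for ∇_X JY against JV; `t2` trades ∇_X JV against CY for J∇_X V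
  -- against CY. The relation `d` links the two.
  have t1 := hM.nablaJ_eq hX.1 hY.1 hJV.1 x
  have t2 := hM.nablaJ_eq hX.1 hV.1 hC.1 x
  have c1 : g.inner x (X x) (J x (cPart (F := F) g J pr Y x)) =
      -g.inner x (cPart (F := F) g J pr Y x) (cPart (F := F) g J pr X x) := by
    have := inner_hProj_left (hC.2 x) (J x (X x))
    rw [g.symm x (cPart (F := F) g J pr Y x) (cPart (F := F) g J pr X x)]
    rw [hH.inner_J_left] at this
    have e : cPart (F := F) g J pr X x = hProj (F := F) g pr x (J x (X x)) := rfl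
    rw [e, this, neg_neg]
  have c2 : lee x (J x (Y x)) =
      g.inner x (bPart (F := F) g J pr Y x) (leeVector g lee x) := by
    rw [hlee, g.symm]
    exact (inner_vProj_left (hLee x) _).symm
  have c3 : g.inner x (cov g X V x) (J x (cPart (F := F) g J pr Y x)) =
      -g.inner x (cPart (F := F) g J pr Y x) (J x (cov g X V x)) := by
    rw [g.symm x (cPart (F := F) g J pr Y x), hH.inner_J_left, neg_neg]
  have c4 := g.symm x (cov g X (jField J V) x) (cPart (F := F) g J pr Y x)
  have l1 := hlee0 _ (hX.2 x)
  have l2 := hlee0 _ (hY.2 x)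
  have l3 := hlee0 _ (hC.2 x)
  have l4 := hlee0 _ hJVx
  simp only [nablaJ] at t1 t2
  rw [c1, c3, c4, hXV, l3, l4] at t2
  have e : jField J V x = J x (V x) := rfl
  rw [e, hH.sq, inner_neg_right, inner_neg_right, map_neg, c2, l2, l4, s] at t1
  rw [a1, a2, ← hlee (V x)]
  linear_combination (-1 / 2 : ℝ) * t1 + d - (1 / 2 : ℝ) * t2

/-- The second fundamental form on `X` and `JY` for horizontal `X`, `Y`. -/
theorem IsAntiInvariantSubmersion.inner_secondFF_jField (h : IsAntiInvariantSubmersion g J gB pr)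
    (hJ : SmoothEnd J)
    (hX : IsHorizontal (F := F) g pr X) (hY : IsHorizontal (F := F) g pr Y)
    (hV : IsVertical (F := F) pr V) (x : M) :
    gB.inner (pr x) (secondFF g gB pr X (jField J Y) x)
        (mfderiv 𝓘(ℝ, E) 𝓘(ℝ, F) pr x (J x (V x))) =
      -g.inner x (oneillA (F := F) g pr X (bPart (F := F) g J pr Y) x) (J x (V x)) := by
  have hR := h.toIsRiemannianSubmersion
  have hC := isHorizontal_cPart hR hJ hY.1
  have hB := isVertical_bPart hR hJ hY.1
  have hJV := h.isHorizontal_jField hJ hV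
  have h0 := hR.inner_secondFF_horizontal hX hC hJV x
  -- π_* kills BY, so JY and CY have the same image; but ∇_X BY need not be vertical, and it
  -- supplies the whole answer.
  have h1 : (fun y => mfderiv 𝓘(ℝ, E) 𝓘(ℝ, F) pr y (jField J Y y)) =
      fun y => mfderiv 𝓘(ℝ, E) 𝓘(ℝ, F) pr y (cPart (F := F) g J pr Y y) :=
    funext fun y => (mfderiv_hProj (J y (Y y))).symm
  have h2 : cov g X (jField J Y) x =
      cov g X (cPart (F := F) g J pr Y) x + cov g X (bPart (F := F) g J pr Y) x := by
    rw [jField_eq (F := F) g J pr Y, cov_add g X hC.1 hB.1]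
  have h3 : secondFF g gB pr X (jField J Y) x = secondFF g gB pr X (cPart (F := F) g J pr Y) x
      - mfderiv 𝓘(ℝ, E) 𝓘(ℝ, F) pr x (cov g X (bPart (F := F) g J pr Y) x) := by
    simp only [secondFF]
    rw [h1, h2, map_add, sub_sub]
  have h4 : gB.inner (pr x) (secondFF g gB pr X (cPart (F := F) g J pr Y) x)
      (mfderiv 𝓘(ℝ, E) 𝓘(ℝ, F) pr x (J x (V x))) = 0 := h0
  rw [h3, inner_sub_left, h4, hR.inner_mfderiv, oneillA_of_horizontal_vertical hX.2 hB.2, zero_sub]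

omit [FiniteDimensional ℝ F] in
-- Horizontality is tested on single vertical vectors; each one extends to a smooth vertical field
-- by extending it arbitrarily and projecting. Involutivity follows from torsion-freeness.
theorem horizTotallyGeodesicFoliation_iff [T2Space M] (h : IsRiemannianSubmersion g gB pr) :
    HorizTotallyGeodesicFoliation (F := F) g pr ↔
      ∀ X Y V : VField E M, IsHorizontal (F := F) g pr X → IsHorizontal (F := F) g pr Y →
        IsVertical (F := F) pr V → ∀ x, g.inner x (cov g X Y x) (V x) = 0 := by
  refine ⟨fun H X Y V hX hY hV x => (H X Y hX hY x).2 _ (hV.2 x), fun H => ?_⟩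
  have hcov : ∀ X Y : VField E M, IsHorizontal (F := F) g pr X → IsHorizontal (F := F) g pr Y →
      ∀ x, cov g X Y x ∈ horiz (F := F) g pr x := by
    intro X Y hX hY x v hv
    obtain ⟨W, hW, rfl⟩ := exists_smoothVF_apply_eq x v
    have := H X Y _ hX hY ⟨hW.vProj h, fun _ => vProj_mem _⟩ x
    rwa [vProj_of_vert hv] at this
  intro X Y hX hY x
  refine ⟨?_, hcov X Y hX hY x⟩
  rw [← cov_sub_cov g hX.1 hY.1]
  exact Submodule.sub_mem _ (hcov X Y hX hY x) (hcov Y X hY hX x)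

end AntiInvariant

end LCK

end

theorem theorem4p1
    {E : Type*} [NormedAddCommGroup E] [NormedSpace ℝ E] [FiniteDimensional ℝ E]
    {M : Type*} [TopologicalSpace M] [ChartedSpace E M] [IsManifold 𝓘(ℝ, E) ∞ M] [T2Space M]
    {F : Type*} [NormedAddCommGroup F] [NormedSpace ℝ F] [FiniteDimensional ℝ F]
    {B : Type*} [TopologicalSpace B] [ChartedSpace F B] [IsManifold 𝓘(ℝ, F) ∞ B] [T2Space B]
    (g : LCK.Metric E M) (J : LCK.EndField E M) (lee : LCK.OneForm E M) (gB : LCK.Metric F B)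
    (pr : M → B)
    (hM : LCK.IsLCK g J lee)
    (hpr : LCK.IsAntiInvariantSubmersion g J gB pr)
    (hLee : ∀ x : M, LCK.leeVector g lee x ∈ LCK.vert (F := F) pr x) :
    List.TFAE
      [LCK.HorizTotallyGeodesicFoliation (F := F) g pr,
       ∀ X Y V : LCK.VField E M, LCK.IsHorizontal (F := F) g pr X →
        LCK.IsHorizontal (F := F) g pr Y → LCK.IsVertical (F := F) pr V → ∀ x : M,
        g.inner x (LCK.oneillA (F := F) g pr X (LCK.bPart (F := F) g J pr Y) x) (J x (V x)) =
          g.inner x (LCK.cPart (F := F) g J pr Y x)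
              (J x (LCK.oneillA (F := F) g pr X V x))
            - 1 / 2 * lee x (V x) *
              g.inner x (LCK.cPart (F := F) g J pr Y x) (LCK.cPart (F := F) g J pr X x)
            + 1 / 2 * g.inner x (LCK.bPart (F := F) g J pr Y x) (LCK.leeVector g lee x)
              * g.inner x (X x) (J x (V x))
            + 1 / 2 * g.inner x (X x) (Y x) * g.inner x (LCK.leeVector g lee x) (V x),
       ∀ X Y V : LCK.VField E M, LCK.IsHorizontal (F := F) g pr X →
        LCK.IsHorizontal (F := F) g pr Y → LCK.IsVertical (F := F) pr V → ∀ x : M,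
        gB.inner (pr x) (LCK.secondFF g gB pr X (LCK.jField J Y) x)
            (mfderiv 𝓘(ℝ, E) 𝓘(ℝ, F) pr x (J x (V x))) =
          - g.inner x (LCK.cPart (F := F) g J pr Y x)
              (J x (LCK.oneillA (F := F) g pr X V x))
            + 1 / 2 * lee x (V x) *
              g.inner x (LCK.cPart (F := F) g J pr Y x) (LCK.cPart (F := F) g J pr X x)
            - 1 / 2 * g.inner x (LCK.bPart (F := F) g J pr Y x) (LCK.leeVector g lee x)
              * g.inner x (X x) (J x (V x))
            - 1 / 2 * g.inner x (X x) (Y x) * g.inner x (LCK.leeVector g lee x) (V x)] := by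
  have hR := hpr.toIsRiemannianSubmersion
  have hnabla := LCK.horizTotallyGeodesicFoliation_iff hR
  tfae_have 1 ↔ 2 := by
    rw [hnabla]
    refine forall₃_congr fun X Y V => forall₄_congr fun hX hY hV x => ?_
    rw [hpr.inner_cov_horizontal hM hLee hX hY hV x]
    exact sub_eq_zero
  tfae_have 2 ↔ 3 := by
    refine forall₃_congr fun X Y V => forall₄_congr fun hX hY hV x => ?_
    -- After this rewriting, (c) is (b) with both sides negated.
    rw [hpr.inner_secondFF_jField hM.hermitian.smooth hX hY hV x]
    constructor <;> intro h <;> linarith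
  tfae_finish
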